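/- **Theorem.** Identify $M_n(\mathbb C)$ with the operators on $\mathbb C^n$, let $\|\cdot\|$ be the spectral norm, and for a subspace $\mathcal S\subseteq\mathbb C^n$ let $\mathcal G(\mathcal S)$ be the set of orthogonal projections acting on $\mathcal S$; put $\mathcal G_n=\mathcal G(\mathbb C^n)$. Curves are piecewise smooth and parametrized by $[0,1]$, and the length of a curve $\delta$ is $L(\delta)=\int_0^1\|\dot\delta(t)\|\,dt$. A *minimal curve* from $P$ to $Q$ is a curve in $\mathcal G_n$ from $P$ to $Q$ with constant speed $\|\dot\delta(t)\|$ (away from its corners) and with the least length among all curves in $\mathcal G_n$ from $P$ to $Q$. Let $P,Q\in\mathcal G_n$ with $\|P-Q\|<1$. Let $X$ be a Hermitian matrix with $X=PX+XP$, $\|X\|<\pi/2$ and $Q=e^{iX}Pe^{-iX}$. Then the spectrum of $|X|=\sqrt{X^*X}$ is contained in $[0,\pi/2)$. Put $S_X=\ker(\|X\|I-|X|)$ and, for $t\in[0,1]$, let $\gamma_X(t)$ be the compression of $e^{itX}Pe^{-itX}$ to $S_X$. If the spectrum of $|X|$ has more than one element, then a function $\delta$ from $[0,1]$ to $M_n(\mathbb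 C)$ is a minimal curve from $P$ to $Q$ if and only if $$ \delta(t)=\begin{pmatrix}\gamma_X(t)&0\\0&\alpha_1(t)\end{pmatrix}\begin{array}{l}S_X\\ S_X^\perp\end{array}\qquad(t\in[0,1]) $$ for some curve $\alpha_1:[0,1]\to\mathcal G(S_X^\perp)$ that joins the compressions $P|_{S_X^\perp}$ and $Q|_{S_X^\perp}$ and satisfies $\|\dot\alpha_1(t)\|\le\|X\|$ wherever $\dot\alpha_1(t)$ exists. -/

import Mathlib

open scoped ContDiff

noncomputable section

/-- A piecewise smooth curve parametrized by `[0, 1]`: there is a finite partition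
`0 = τ 0 ≤ τ 1 ≤ ⋯ ≤ τ N = 1` such that the curve is `C^∞`, up to the endpoints, on each closed
piece. In particular it is continuous on `[0, 1]`. Values outside `[0, 1]` are irrelevant. -/
def IsPiecewiseSmooth {A : Type*} [NormedAddCommGroup A] [NormedSpace ℝ A] (α : ℝ → A) : Prop :=
  ∃ (N : ℕ) (τ : ℕ → ℝ), Monotone τ ∧ τ 0 = 0 ∧ τ N = 1 ∧
    ∀ k < N, ContDiffOn ℝ ∞ α (Set.Icc (τ k) (τ (k + 1)))

/-- The length `∫₀¹ ‖α'(t)‖ dt` of a curve. -/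
def curveLength {A : Type*} [NormedAddCommGroup A] [NormedSpace ℝ A] (α : ℝ → A) : ℝ :=
  ∫ t in (0 : ℝ)..1, ‖deriv α t‖

/-- The speed of the curve is constant (wherever the derivative exists in `(0, 1)`, that is,
everywhere but possibly at finitely many corners when the curve is piecewise smooth). -/
def HasConstantSpeed {A : Type*} [NormedAddCommGroup A] [NormedSpace ℝ A] (α : ℝ → A) : Prop :=
  ∃ c : ℝ, ∀ t ∈ Set.Ioo (0 : ℝ) 1, DifferentiableAt ℝ α t → ‖deriv α t‖ = c

/-- The speed of the curve is at most `c` (wherever the derivative exists in `(0, 1)`). -/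
def HasSpeedLE {A : Type*} [NormedAddCommGroup A] [NormedSpace ℝ A] (α : ℝ → A) (c : ℝ) : Prop :=
  ∀ t ∈ Set.Ioo (0 : ℝ) 1, DifferentiableAt ℝ α t → ‖deriv α t‖ ≤ c

section Operators

variable {E : Type*} [NormedAddCommGroup E] [InnerProductSpace ℂ E]

/-- The Grassmannian of `E`: the set of orthogonal projections of `E`, inside the algebra of
operators of `E` with the operator (spectral) norm. -/
def grassmannian (E : Type*) [NormedAddCommGroup E] [InnerProductSpace ℂ E] [CompleteSpace E] :
    Set (E →L[ℂ] E) :=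
  {P | IsStarProjection P}

/-- `X` is tangent to the Grassmannian at the projection `P`: it is Hermitian and
`P`-codiagonal. -/
def IsTangentAt [CompleteSpace E] (P X : E →L[ℂ] E) : Prop :=
  IsSelfAdjoint X ∧ X = P * X + X * P

/-- `α` is a piecewise smooth curve in the Grassmannian of `E` from `P` to `Q`. -/
structure IsGrassmannCurve [CompleteSpace E] (P Q : E →L[ℂ] E) (α : ℝ → E →L[ℂ] E) : Prop where
  piecewiseSmooth : IsPiecewiseSmooth α
  mem : ∀ t ∈ Set.Icc (0 : ℝ) 1, α t ∈ grassmannian E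
  source : α 0 = P
  target : α 1 = Q

/-- `δ` is a minimal curve from `P` to `Q` in the Grassmannian: a piecewise smooth curve,
parametrized by `[0, 1]` with constant speed, whose length is the least among all the piecewise
smooth curves in the Grassmannian from `P` to `Q`. -/
structure IsMinimalCurve [CompleteSpace E] (P Q : E →L[ℂ] E) (δ : ℝ → E →L[ℂ] E) : Prop where
  isCurve : IsGrassmannCurve P Q δ
  constantSpeed : HasConstantSpeed δ
  minimal : ∀ β : ℝ → E →L[ℂ] E, IsGrassmannCurve P Q β → curveLength δ ≤ curveLength β

/-- The geodesic `t ↦ e^{itX} P e^{-itX}`. -/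
def geodesic [CompleteSpace E] (P X : E →L[ℂ] E) (t : ℝ) : E →L[ℂ] E :=
  NormedSpace.exp ((Complex.I * (t : ℂ)) • X) * P * NormedSpace.exp (-(Complex.I * (t : ℂ)) • X)

/-- The compression to the subspace `S` of an operator `T` of `E`; it is the restriction
of `T` when `S` is invariant under `T`. -/
def compression (S : Submodule ℂ E) [S.HasOrthogonalProjection] (T : E →L[ℂ] E) : S →L[ℂ] S :=
  S.orthogonalProjectionOnto ∘L T ∘L S.subtypeL

/-- The block diagonal operator with blocks `A` on `S` and `B` on `Sᗮ`. -/
def blockDiag (S : Submodule ℂ E) [S.HasOrthogonalProjection] (A : S →L[ℂ] S) (B : Sᗮ →L[ℂ] Sᗮ) :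
    E →L[ℂ] E :=
  S.subtypeL ∘L A ∘L S.orthogonalProjectionOnto + Sᗮ.subtypeL ∘L B ∘L Sᗮ.orthogonalProjectionOnto

/-- The subspace `S_X = ker (‖X‖ I - |X|)`, where `|X| = √(X⋆ X)`. -/
def maxSubspace [CompleteSpace E] (X : E →L[ℂ] E) : Submodule ℂ E :=
  LinearMap.ker ((‖X‖ : ℂ) • (1 : E →L[ℂ] E) - CFC.abs X).toLinearMap

/-- The compressed geodesic `γ_X(t)`, the compression of `e^{itX} P e^{-itX}` to `S_X`. -/
def compressedGeodesic [CompleteSpace E] (P X : E →L[ℂ] E) [(maxSubspace X).HasOrthogonalProjection]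
    (t : ℝ) : maxSubspace X →L[ℂ] maxSubspace X :=
  compression (maxSubspace X) (geodesic P X t)

end Operators

end

/-! ### Calculus of piecewise smooth curves: corners, length and speed. -/

section PiecewiseSmooth

variable {A : Type*} [NormedAddCommGroup A] [NormedSpace ℝ A] {α β : ℝ → A}

/-! Fix a unit vector `v`. Along a curve `β` of projections, the angle `arccos (2⟨βv, v⟩ - 1)` moves
at rate at most twice the speed of `β`, because the derivative of a curve of projections is
codiagonal (`IsGrassmannCurve.abs_arccos_sub_arccos_le`).

The space `S_X` is spanned by principal pairs: unit vectors `ξ` in the range and `η` in the kernel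
of `P` with `Xξ = ‖X‖η` and `Xη = ‖X‖ξ`. The geodesic turns the angle of such a `ξ` by `2‖X‖ < π`,
so every curve from `P` to `Q` has length at least `‖X‖`, the length of the geodesic. Minimal curves
are therefore the curves of speed at most `‖X‖`.

For such a curve, the angle bounds measured from both endpoints on `ξ`, `η` and their rotated copies
leave no freedom: the curve agrees with the geodesic on `ξ` and `η`
(`IsPrincipalPair.apply_eq_geodesic_apply`), hence on `S_X`. Being Hermitian, it is then block
diagonal, with an arbitrary second block of speed at most `‖X‖`. Conversely, the norm of a block
diagonal operator is the larger of the norms of its blocks, so any such second block gives a curve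
of speed at most `‖X‖`. -/

theorem ContDiff.isPiecewiseSmooth (h : ContDiff ℝ ∞ α) : IsPiecewiseSmooth α :=
  ⟨1, fun k => (k : ℝ), Nat.mono_cast, by simp, by simp, fun _ _ => h.contDiffOn⟩

theorem IsPiecewiseSmooth.congr (h : IsPiecewiseSmooth α)
    (hαβ : ∀ t ∈ Set.Icc (0 : ℝ) 1, β t = α t) : IsPiecewiseSmooth β := by
  obtain ⟨N, τ, hτ, h0, h1, hs⟩ := h
  refine ⟨N, τ, hτ, h0, h1, fun k hk => (hs k hk).congr fun t ht => hαβ t ⟨?_, ?_⟩⟩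
  · exact (h0 ▸ hτ (Nat.zero_le k)).trans ht.1
  · exact ht.2.trans (h1 ▸ hτ hk)

theorem IsPiecewiseSmooth.contDiff_comp {B C : Type*} [NormedAddCommGroup B] [NormedSpace ℝ B]
    [NormedAddCommGroup C] [NormedSpace ℝ C] (h : IsPiecewiseSmooth α) {γ : ℝ → B}
    (hγ : ContDiff ℝ ∞ γ) {F : B × A → C} (hF : ContDiff ℝ ∞ F) :
    IsPiecewiseSmooth fun t => F (γ t, α t) := by
  obtain ⟨N, τ, hτ, h0, h1, hs⟩ := h
  exact ⟨N, τ, hτ, h0, h1, fun k hk => hF.comp_contDiffOn (hγ.contDiffOn.prodMk (hs k hk))⟩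

theorem IsPiecewiseSmooth.continuousOn (h : IsPiecewiseSmooth α) :
    ContinuousOn α (Set.Icc 0 1) := by
  obtain ⟨N, τ, hτ, h0, h1, hs⟩ := h
  have key : ∀ n ≤ N, ContinuousOn α (Set.Icc (τ 0) (τ n)) := by
    intro n hn
    induction n with
    | zero => simp
    | succ n ih =>
      rw [← Set.Icc_union_Icc_eq_Icc (hτ (Nat.zero_le n)) (hτ n.le_succ)]
      exact (ih (by omega)).union_of_isClosed (hs n (by omega)).continuousOn
        isClosed_Icc isClosed_Icc
  simpa [h0, h1] using key N le_rfl

theorem IsPiecewiseSmooth.exists_countable (h : IsPiecewiseSmooth α) :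
    ∃ s : Set ℝ, s.Countable ∧ ∀ t ∈ Set.Ioo (0 : ℝ) 1 \ s, DifferentiableAt ℝ α t := by
  obtain ⟨N, τ, hτ, h0, h1, hs⟩ := h
  refine ⟨Set.range τ, Set.countable_range τ, ?_⟩
  have key : ∀ n ≤ N, ∀ t ∈ Set.Ioo (τ 0) (τ n) \ Set.range τ, DifferentiableAt ℝ α t := by
    intro n hn
    induction n with
    | zero => simp
    | succ n ih =>
      rintro t ⟨ht, hts⟩
      rcases lt_trichotomy t (τ n) with hlt | heq | hgt
      · exact ih (by omega) t ⟨⟨ht.1, hlt⟩, hts⟩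
      · exact absurd ⟨n, heq.symm⟩ hts
      · exact ((hs n (by omega)).contDiffAt (Icc_mem_nhds hgt ht.2)).differentiableAt (by simp)
  simpa [h0, h1] using key N le_rfl

theorem ContDiffOn.intervalIntegrable_deriv {a b : ℝ} (hab : a ≤ b)
    (h : ContDiffOn ℝ ∞ α (Set.Icc a b)) :
    IntervalIntegrable (deriv α) MeasureTheory.volume a b := by
  rcases hab.eq_or_lt with rfl | hlt
  · exact IntervalIntegrable.refl
  have hc := h.continuousOn_derivWithin (uniqueDiffOn_Icc hlt) (by simp)
  refine (hc.intervalIntegrable_of_Icc hab).congr_ae ?_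
  rw [Set.uIoc_of_le hab, ← MeasureTheory.restrict_Ioo_eq_restrict_Ioc]
  filter_upwards [MeasureTheory.ae_restrict_mem measurableSet_Ioo] with t ht
  exact derivWithin_of_mem_nhds (Icc_mem_nhds ht.1 ht.2)

theorem IsPiecewiseSmooth.intervalIntegrable_norm_deriv (h : IsPiecewiseSmooth α) :
    IntervalIntegrable (fun t => ‖deriv α t‖) MeasureTheory.volume 0 1 := by
  obtain ⟨N, τ, hτ, h0, h1, hs⟩ := h
  rw [← h0, ← h1]
  exact (IntervalIntegrable.trans_iterate fun k hk =>
    (hs k hk).intervalIntegrable_deriv (hτ k.le_succ)).norm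

theorem IsPiecewiseSmooth.ae_differentiableAt (h : IsPiecewiseSmooth α) :
    ∀ᵐ t : ℝ, t ∈ Set.Ioo (0 : ℝ) 1 → DifferentiableAt ℝ α t := by
  obtain ⟨s, hs, hd⟩ := h.exists_countable
  filter_upwards [hs.ae_notMem MeasureTheory.volume] with t hts ht using hd t ⟨ht, hts⟩

theorem HasSpeedLE.integral_le {c : ℝ} (h : HasSpeedLE α c) (hα : IsPiecewiseSmooth α) {a b : ℝ}
    (ha : 0 ≤ a) (hab : a ≤ b) (hb : b ≤ 1) : ∫ t in a..b, ‖deriv α t‖ ≤ c * (b - a) := by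
  have : ∫ t in a..b, ‖deriv α t‖ ≤ ∫ _ in a..b, c := by
    refine intervalIntegral.integral_mono_ae_restrict hab
      (hα.intervalIntegrable_norm_deriv.mono_set ?_) (by simp) ?_
    · rw [Set.uIcc_of_le hab, Set.uIcc_of_le zero_le_one]
      exact Set.Icc_subset_Icc ha hb
    · rw [← MeasureTheory.restrict_Ioo_eq_restrict_Icc]
      filter_upwards [MeasureTheory.ae_restrict_mem measurableSet_Ioo,
        MeasureTheory.ae_restrict_of_ae hα.ae_differentiableAt] with t ht hd
      have ht' : t ∈ Set.Ioo (0 : ℝ) 1 := ⟨ha.trans_lt ht.1, ht.2.trans_le hb⟩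
      exact h t ht' (hd ht')
  simpa [mul_comm] using this

theorem HasSpeedLE.curveLength_le {c : ℝ} (h : HasSpeedLE α c) (hα : IsPiecewiseSmooth α) :
    curveLength α ≤ c := by
  simpa [curveLength] using h.integral_le hα le_rfl zero_le_one le_rfl

theorem HasConstantSpeed.hasSpeedLE_curveLength (h : HasConstantSpeed α)
    (hα : IsPiecewiseSmooth α) : HasSpeedLE α (curveLength α) := by
  obtain ⟨c, hc⟩ := h
  have : curveLength α = ∫ _ in (0 : ℝ)..1, c := by
    refine intervalIntegral.integral_congr_ae_restrict ?_
    rw [Set.uIoc_of_le zero_le_one, ← MeasureTheory.restrict_Ioo_eq_restrict_Ioc]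
    filter_upwards [MeasureTheory.ae_restrict_mem measurableSet_Ioo,
      MeasureTheory.ae_restrict_of_ae hα.ae_differentiableAt] with t ht hd
    exact hc t ht (hd ht)
  intro t ht hd
  rw [this, hc t ht hd]
  simp

end PiecewiseSmooth

/-! ### A differential inequality for arccosines. -/

theorem abs_arccos_sub_arccos_le_of_lt_one {g g' ρ : ℝ → ℝ} {a b : ℝ} (hab : a ≤ b) {s : Set ℝ}
    (hs : s.Countable) (hg : ContinuousOn g (Set.Icc a b)) (hg1 : ∀ t ∈ Set.Icc a b, |g t| ≤ 1)
    (hd : ∀ t ∈ Set.Ioo a b \ s, HasDerivAt g (g' t) t)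
    (hb : ∀ t ∈ Set.Ioo a b \ s, |g' t| ≤ ρ t * √(1 - g t ^ 2))
    (hρ0 : ∀ t, 0 ≤ ρ t) (hρ : IntervalIntegrable ρ MeasureTheory.volume a b)
    {κ : ℝ} (hκ : κ ∈ Set.Ioo (0 : ℝ) 1) :
    |Real.arccos (κ * g b) - Real.arccos (κ * g a)| ≤ ∫ t in a..b, ρ t := by
  -- The factor `κ < 1` keeps the argument away from `±1`, where `arccos` is not differentiable. It
  -- is sent to `1` in the next theorem.
  set F : ℝ → ℝ := fun t => Real.arccos (κ * g t) with hF
  have hlt : ∀ t ∈ Set.Icc a b, |κ * g t| < 1 := fun t ht => by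
    rw [abs_mul, abs_of_pos hκ.1]
    nlinarith [hg1 t ht, hκ.1, hκ.2, abs_nonneg (g t)]
  have hder : ∀ t ∈ Set.Ioo a b \ s,
      HasDerivAt F (-(1 / √(1 - (κ * g t) ^ 2)) * (κ * g' t)) t := fun t ht => by
    have h1 := abs_lt.mp (hlt t (Set.Ioo_subset_Icc_self ht.1))
    exact HasDerivAt.comp (h₂ := Real.arccos) (h := fun t => κ * g t) t
      (Real.hasDerivAt_arccos h1.1.ne' h1.2.ne) ((hd t ht).const_mul κ)
  have hbound : ∀ t ∈ Set.Ioo a b \ s, ‖deriv F t‖ ≤ ρ t := fun t ht => by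
    have h1 := hlt t (Set.Ioo_subset_Icc_self ht.1)
    have hpos : 0 < 1 - (κ * g t) ^ 2 := by
      have := (sq_lt_one_iff_abs_lt_one (κ * g t)).mpr h1
      linarith
    -- Shrinking by `κ` preserves the hypothesis, since `κ² - κ²g² ≤ 1 - κ²g²`.
    have hle : κ * √(1 - g t ^ 2) ≤ √(1 - (κ * g t) ^ 2) := by
      apply Real.le_sqrt_of_sq_le
      have h2 := (sq_le_one_iff_abs_le_one (g t)).mpr (hg1 t (Set.Ioo_subset_Icc_self ht.1))
      rw [mul_pow, Real.sq_sqrt (by linarith)]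
      nlinarith [hκ.1, hκ.2]
    rw [(hder t ht).deriv, Real.norm_eq_abs, abs_mul, abs_neg, abs_of_nonneg (by positivity),
      abs_mul, abs_of_pos hκ.1, one_div, inv_mul_le_iff₀ (Real.sqrt_pos.mpr hpos)]
    calc κ * |g' t| ≤ κ * (ρ t * √(1 - g t ^ 2)) := by gcongr; exacts [hκ.1.le, hb t ht]
      _ = ρ t * (κ * √(1 - g t ^ 2)) := by ring
      _ ≤ ρ t * √(1 - (κ * g t) ^ 2) := by gcongr; exact hρ0 t
      _ = _ := by ring
  have hae : ∀ᵐ t : ℝ, t ∈ Set.Ioc a b → ‖deriv F t‖ ≤ ρ t := by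
    filter_upwards [hs.ae_notMem MeasureTheory.volume,
      (Set.countable_singleton b).ae_notMem MeasureTheory.volume] with t hts htb ht
    exact hbound t ⟨⟨ht.1, lt_of_le_of_ne ht.2 htb⟩, hts⟩
  have hint : IntervalIntegrable (deriv F) MeasureTheory.volume a b := by
    refine hρ.mono_fun (aestronglyMeasurable_deriv F _) ?_
    rw [Set.uIoc_of_le hab]
    filter_upwards [(MeasureTheory.ae_restrict_iff' measurableSet_Ioc).mpr hae] with t ht
    exact ht.trans (Real.le_norm_self _)
  have hFTC := MeasureTheory.integral_eq_of_hasDerivAt_off_countable_of_le F (deriv F) hab hs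
    (Real.continuous_arccos.comp_continuousOn (continuousOn_const.mul hg))
    (fun t ht => (hder t ht).differentiableAt.hasDerivAt) hint
  have := intervalIntegral.norm_integral_le_of_norm_le hab hae hρ
  rwa [hFTC] at this

theorem abs_arccos_sub_arccos_le {g g' ρ : ℝ → ℝ} {a b : ℝ} (hab : a ≤ b) {s : Set ℝ}
    (hs : s.Countable) (hg : ContinuousOn g (Set.Icc a b)) (hg1 : ∀ t ∈ Set.Icc a b, |g t| ≤ 1)
    (hd : ∀ t ∈ Set.Ioo a b \ s, HasDerivAt g (g' t) t)
    (hb : ∀ t ∈ Set.Ioo a b \ s, |g' t| ≤ ρ t * √(1 - g t ^ 2))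
    (hρ0 : ∀ t, 0 ≤ ρ t) (hρ : IntervalIntegrable ρ MeasureTheory.volume a b) :
    |Real.arccos (g b) - Real.arccos (g a)| ≤ ∫ t in a..b, ρ t := by
  have hlim : Filter.Tendsto (fun κ : ℝ => |Real.arccos (κ * g b) - Real.arccos (κ * g a)|)
      (nhdsWithin 1 (Set.Iio 1)) (nhds |Real.arccos (1 * g b) - Real.arccos (1 * g a)|) := by
    refine Filter.Tendsto.mono_left (Continuous.tendsto ?_ 1) nhdsWithin_le_nhds
    exact ((Real.continuous_arccos.comp (by fun_prop)).sub
      (Real.continuous_arccos.comp (by fun_prop))).abs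
  simp only [one_mul] at hlim
  refine le_of_tendsto hlim ?_
  filter_upwards [Ioo_mem_nhdsLT (zero_lt_one (α := ℝ))] with κ hκ
  exact abs_arccos_sub_arccos_le_of_lt_one hab hs hg hg1 hd hb hρ0 hρ hκ

/-! ### Angle estimate along curves of projections. -/

section Projection

variable {E : Type*} [NormedAddCommGroup E] [InnerProductSpace ℂ E] [CompleteSpace E]

theorem IsStarProjection.inner_apply_self {T : E →L[ℂ] E} (hT : IsStarProjection T) (v : E) :
    inner ℂ (T v) v = ((‖T v‖ ^ 2 : ℝ) : ℂ) := by
  have h1 : T (T v) = T v := congr($(hT.isIdempotentElem.eq) v)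
  have h2 := (ContinuousLinearMap.isSelfAdjoint_iff_isSymmetric.mp hT.isSelfAdjoint) (T v) v
  simp only [ContinuousLinearMap.coe_coe, h1] at h2
  rw [h2, inner_self_eq_norm_sq_to_K]
  simp

theorem IsStarProjection.re_inner_apply_self {T : E →L[ℂ] E} (hT : IsStarProjection T) (v : E) :
    (inner ℂ (T v) v).re = ‖T v‖ ^ 2 := by
  rw [hT.inner_apply_self]
  exact Complex.ofReal_re _

theorem IsStarProjection.norm_sq_add_norm_sq {T : E →L[ℂ] E} (hT : IsStarProjection T) (v : E) :
    ‖T v‖ ^ 2 + ‖v - T v‖ ^ 2 = ‖v‖ ^ 2 := by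
  have h1 := hT.re_inner_apply_self v
  have h2 := hT.one_sub.re_inner_apply_self v
  have h3 : (inner ℂ v v).re = ‖v‖ ^ 2 := by
    rw [inner_self_eq_norm_sq_to_K]
    norm_cast
  simp only [sub_apply, one_apply_eq_self, inner_sub_left, Complex.sub_re] at h2
  linarith

theorem IsStarProjection.abs_two_mul_re_inner_sub_one_le {T : E →L[ℂ] E} (hT : IsStarProjection T)
    {v : E} (hv : ‖v‖ = 1) : |2 * (inner ℂ (T v) v).re - 1| ≤ 1 := by
  have h := hT.norm_sq_add_norm_sq v
  rw [hT.re_inner_apply_self, abs_le]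
  rw [hv] at h
  constructor <;> nlinarith [sq_nonneg ‖T v‖, sq_nonneg ‖v - T v‖]

/-- Codiagonality gives `TDT = 0` and leaves only the cross term `2 Re⟨D(Tv), v - Tv⟩` of `⟨Dv, v⟩`.
By Pythagoras, the square root equals `2‖Tv‖‖v - Tv‖`, so Cauchy–Schwarz finishes. -/
theorem IsStarProjection.abs_re_inner_le_of_codiagonal {T D : E →L[ℂ] E} (hT : IsStarProjection T)
    (hD : IsSelfAdjoint D) (hTD : D = T * D + D * T) {v : E} (hv : ‖v‖ = 1) :
    |2 * (inner ℂ (D v) v).re| ≤ 2 * ‖D‖ * √(1 - (2 * (inner ℂ (T v) v).re - 1) ^ 2) := by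
  have hsq := hT.norm_sq_add_norm_sq v
  have hDs := ContinuousLinearMap.isSelfAdjoint_iff_isSymmetric.mp hD
  have hTs := ContinuousLinearMap.isSelfAdjoint_iff_isSymmetric.mp hT.isSelfAdjoint
  have hDv : ∀ w, D w = T (D w) + D (T w) := fun w => congr($hTD w)
  have hTDT : T (D (T v)) = 0 := by
    have := hDv (T v)
    rw [show T (T v) = T v from congr($(hT.isIdempotentElem.eq) v)] at this
    simpa using this
  have h1 : (inner ℂ (D v) v).re = 2 * (inner ℂ (D (T v)) (v - T v)).re := by
    have e1 : inner ℂ (T (D v)) v = inner ℂ (D v) (T v) := hTs _ _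
    have e2 : inner ℂ (D v) (T v) = inner ℂ v (D (T v)) := hDs _ _
    have e3 : inner ℂ (D (T v)) (T v) = inner ℂ (T (D (T v))) v := (hTs _ _).symm
    rw [hTDT, inner_zero_left] at e3
    rw [inner_sub_right, e3, sub_zero]
    conv_lhs => rw [hDv v]
    rw [inner_add_left, e1, e2, Complex.add_re, ← inner_conj_symm, Complex.conj_re]
    ring
  have h2 : √(1 - (2 * (inner ℂ (T v) v).re - 1) ^ 2) = 2 * (‖T v‖ * ‖v - T v‖) := by
    rw [hT.re_inner_apply_self, ← Real.sqrt_sq (by positivity : 0 ≤ 2 * (‖T v‖ * ‖v - T v‖))]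
    congr 1
    rw [hv] at hsq
    linear_combination (-4 * ‖T v‖ ^ 2) * hsq
  rw [h1, h2]
  have h3 : |(inner ℂ (D (T v)) (v - T v)).re| ≤ ‖D‖ * ‖T v‖ * ‖v - T v‖ :=
    (Complex.abs_re_le_norm _).trans ((norm_inner_le_norm _ _).trans
      (by gcongr; exact D.le_opNorm _))
  rw [abs_mul, abs_mul, abs_two]
  linarith

/-- Differentiate `β⋆ = β` and `β² = β`. -/
theorem HasDerivAt.codiagonal_of_isStarProjection {β : ℝ → E →L[ℂ] E} {D : E →L[ℂ] E} {t : ℝ}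
    (h : HasDerivAt β D t) (hβ : ∀ᶠ s in nhds t, IsStarProjection (β s)) :
    IsSelfAdjoint D ∧ D = β t * D + D * β t := by
  constructor
  · have h1 : HasDerivAt (fun s => star (β s)) (star D) t := h.star
    refine h1.unique (h.congr_of_eventuallyEq ?_)
    filter_upwards [hβ] with s hs using hs.isSelfAdjoint
  · have h1 := h.mul h
    rw [add_comm]
    refine h.unique (h1.congr_of_eventuallyEq ?_)
    filter_upwards [hβ] with s hs using hs.isIdempotentElem.symm

/-- Since `2⟨βv, v⟩ - 1 = cos 2θ` with `cos θ = ‖βv‖`, the arccosine is twice the angle between `v`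
and the range of `β`. -/
theorem IsGrassmannCurve.abs_arccos_sub_arccos_le {P Q : E →L[ℂ] E} {β : ℝ → E →L[ℂ] E}
    (h : IsGrassmannCurve P Q β) {v : E} (hv : ‖v‖ = 1) {a b : ℝ} (ha : 0 ≤ a) (hab : a ≤ b)
    (hb : b ≤ 1) :
    |Real.arccos (2 * (inner ℂ (β b v) v).re - 1) - Real.arccos (2 * (inner ℂ (β a v) v).re - 1)|
      ≤ 2 * ∫ t in a..b, ‖deriv β t‖ := by
  obtain ⟨s, hs, hd⟩ := h.piecewiseSmooth.exists_countable
  have hsub : Set.Icc a b ⊆ Set.Icc 0 1 := Set.Icc_subset_Icc ha hb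
  have hIoo : ∀ t ∈ Set.Ioo a b, t ∈ Set.Ioo (0 : ℝ) 1 := fun t ht =>
    ⟨ha.trans_lt ht.1, ht.2.trans_le hb⟩
  let Λ : (E →L[ℂ] E) →L[ℝ] ℝ := (2 : ℝ) • (Complex.reCLM ∘L
    ((innerSL ℂ v).restrictScalars ℝ) ∘L ((ContinuousLinearMap.apply ℂ E v).restrictScalars ℝ))
  have hΛ : ∀ T, Λ T = 2 * (inner ℂ (T v) v).re := fun T => by
    simp only [Λ, smul_apply, ContinuousLinearMap.comp_apply, smul_eq_mul,
      ContinuousLinearMap.coe_restrictScalars', ContinuousLinearMap.apply_apply, innerSL_apply_apply,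
      Complex.reCLM_apply]
    rw [← inner_conj_symm, Complex.conj_re]
  rw [← intervalIntegral.integral_const_mul]
  simp only [← hΛ]
  refine _root_.abs_arccos_sub_arccos_le (g := fun t => Λ (β t) - 1)
    (g' := fun t => Λ (deriv β t)) hab hs ?_ ?_ ?_ ?_ (fun t => by positivity) ?_
  · exact (Λ.continuous.comp_continuousOn (h.piecewiseSmooth.continuousOn.mono hsub)).sub
      continuousOn_const
  · intro t ht
    rw [hΛ]
    exact IsStarProjection.abs_two_mul_re_inner_sub_one_le (h.mem t (hsub ht)) hv
  · intro t ht
    exact (Λ.hasFDerivAt.comp_hasDerivAt t (hd t ⟨hIoo t ht.1, ht.2⟩).hasDerivAt).sub_const 1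
  · intro t ht
    have ht' := hIoo t ht.1
    have hev : ∀ᶠ s in nhds t, IsStarProjection (β s) := by
      filter_upwards [Icc_mem_nhds ht'.1 ht'.2] with s hs using h.mem s hs
    obtain ⟨h1, h2⟩ := (hd t ⟨ht', ht.2⟩).hasDerivAt.codiagonal_of_isStarProjection hev
    simp only [hΛ]
    exact hev.self_of_nhds.abs_re_inner_le_of_codiagonal h1 h2 hv
  · refine (h.piecewiseSmooth.intervalIntegrable_norm_deriv.mono_set ?_).const_mul 2
    rwa [Set.uIcc_of_le hab, Set.uIcc_of_le zero_le_one]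

end Projection

/-! ### Principal pairs and their rotations. -/

section PrincipalPair

variable {E : Type*} [NormedAddCommGroup E] [InnerProductSpace ℂ E]

/-- Orthonormal vectors `ξ ∈ ran P` and `η ∈ ker P` that are interchanged by `X`, up to the
factor `d`. -/
structure IsPrincipalPair (P X : E →L[ℂ] E) (d : ℝ) (ξ η : E) : Prop where
  map_left : X ξ = (d : ℂ) • η
  map_right : X η = (d : ℂ) • ξ
  proj_left : P ξ = ξ
  proj_right : P η = 0
  norm_left : ‖ξ‖ = 1
  norm_right : ‖η‖ = 1
  inner_eq_zero : inner ℂ ξ η = 0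

theorem IsPrincipalPair.norm_smul_add_smul_sq {P X : E →L[ℂ] E} {d : ℝ}
    {ξ η : E} (h : IsPrincipalPair P X d ξ η) (a b : ℂ) :
    ‖a • ξ + b • η‖ ^ 2 = ‖a‖ ^ 2 + ‖b‖ ^ 2 := by
  have := norm_add_sq_eq_norm_sq_add_norm_sq_of_inner_eq_zero (𝕜 := ℂ) (a • ξ) (b • η)
    (by rw [inner_smul_left, inner_smul_right, h.inner_eq_zero]; simp)
  rw [norm_smul, norm_smul, h.norm_left, h.norm_right] at this
  linarith

theorem IsPrincipalPair.norm_rotation_left {P X : E →L[ℂ] E} {d : ℝ} {ξ η : E}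
    (h : IsPrincipalPair P X d ξ η) (θ : ℝ) :
    ‖(Real.cos θ : ℂ) • ξ + (Complex.I * Real.sin θ) • η‖ = 1 := by
  have := h.norm_smul_add_smul_sq (Real.cos θ) (Complex.I * Real.sin θ)
  rw [norm_mul, Complex.norm_I, one_mul, Complex.norm_real, Complex.norm_real, Real.norm_eq_abs,
    Real.norm_eq_abs, sq_abs, sq_abs, Real.cos_sq_add_sin_sq] at this
  exact (pow_eq_one_iff_of_nonneg (norm_nonneg _) two_ne_zero).mp this

theorem IsPrincipalPair.norm_rotation_right {P X : E →L[ℂ] E} {d : ℝ} {ξ η : E}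
    (h : IsPrincipalPair P X d ξ η) (θ : ℝ) :
    ‖(Real.cos θ : ℂ) • η + (Complex.I * Real.sin θ) • ξ‖ = 1 := by
  have := h.norm_smul_add_smul_sq (Complex.I * Real.sin θ) (Real.cos θ)
  rw [norm_mul, Complex.norm_I, one_mul, Complex.norm_real, Complex.norm_real, Real.norm_eq_abs,
    Real.norm_eq_abs, sq_abs, sq_abs, Real.sin_sq_add_cos_sq, add_comm] at this
  exact (pow_eq_one_iff_of_nonneg (norm_nonneg _) two_ne_zero).mp this

end PrincipalPair

/-! ### The geodesic: smoothness, speed, action on a principal pair. -/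

section Geodesic

variable {E : Type*} [NormedAddCommGroup E] [InnerProductSpace ℂ E] [CompleteSpace E]

theorem geodesic_eq (P X : E →L[ℂ] E) (t : ℝ) :
    geodesic P X t =
      NormedSpace.exp (t • (Complex.I • X)) * P * NormedSpace.exp (t • -(Complex.I • X)) := by
  have h : (Complex.I * (t : ℂ)) • X = t • (Complex.I • X) := by
    rw [mul_comm, mul_smul, Complex.coe_smul]
  rw [geodesic, neg_smul, h, smul_neg]

theorem contDiff_geodesic (P X : E →L[ℂ] E) : ContDiff ℝ ∞ (geodesic P X) := by
  have h : ∀ Y : E →L[ℂ] E, ContDiff ℝ ∞ fun t : ℝ => NormedSpace.exp (t • Y) := fun Y =>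
    ContDiff.comp (g := NormedSpace.exp)
      (contDiff_iff_contDiffAt.mpr fun x => (NormedSpace.exp_analytic (𝕂 := ℝ) x).contDiffAt)
      (contDiff_id.smul contDiff_const)
  rw [show geodesic P X = _ from funext (geodesic_eq P X)]
  exact ((h _).mul contDiff_const).mul (h _)

theorem star_exp_smul_I_smul {X : E →L[ℂ] E} (hX : IsSelfAdjoint X) (t : ℝ) :
    star (NormedSpace.exp (t • (Complex.I • X))) = NormedSpace.exp (t • -(Complex.I • X)) := by
  rw [NormedSpace.star_exp]
  simp [star_smul, hX.star_eq]

theorem exp_smul_I_smul_mem_unitary {X : E →L[ℂ] E} (hX : IsSelfAdjoint X) (t : ℝ) :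
    NormedSpace.exp (t • (Complex.I • X)) ∈ unitary (E →L[ℂ] E) := by
  let _ : NormedAlgebra ℚ (E →L[ℂ] E) := NormedAlgebra.restrictScalars ℚ ℂ _
  refine NormedSpace.exp_mem_unitary_of_mem_skewAdjoint ?_
  rw [skewAdjoint.mem_iff]
  simp [star_smul, hX.star_eq]

theorem isStarProjection_geodesic {P X : E →L[ℂ] E} (hP : IsStarProjection P)
    (hX : IsSelfAdjoint X) (t : ℝ) : IsStarProjection (geodesic P X t) := by
  have hU := exp_smul_I_smul_mem_unitary hX t
  rw [geodesic_eq, ← star_exp_smul_I_smul hX]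
  set U := NormedSpace.exp (t • (Complex.I • X))
  refine ⟨?_, IsSelfAdjoint.conjugate hP.isSelfAdjoint U⟩
  calc U * P * star U * (U * P * star U) = U * P * (star U * U) * P * star U := by noncomm_ring
    _ = U * (P * P) * star U := by rw [Unitary.star_mul_self_of_mem hU]; noncomm_ring
    _ = U * P * star U := by rw [hP.isIdempotentElem.eq]

/-- The derivative is `i(XP - PX)` conjugated by a unitary. For codiagonal `X` the commutator is
`X(2P - 1)`, and the reflection `2P - 1` is unitary. -/
theorem norm_deriv_geodesic {P X : E →L[ℂ] E} (hP : IsStarProjection P) (hX : IsTangentAt P X)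
    (t : ℝ) : ‖deriv (geodesic P X) t‖ = ‖X‖ := by
  have hU := exp_smul_I_smul_mem_unitary hX.1 t
  have h1 := ((hasDerivAt_exp_smul_const (𝕂 := ℝ) (Complex.I • X) t).mul_const P).mul
    (hasDerivAt_exp_smul_const' (𝕂 := ℝ) (-(Complex.I • X)) t)
  have hR : (2 : ℂ) • P - 1 ∈ unitary (E →L[ℂ] E) := by
    have hs : star ((2 : ℂ) • P - 1) = (2 : ℂ) • P - 1 := by
      simp [star_sub, star_smul, hP.isSelfAdjoint.star_eq]
    have hm : ((2 : ℂ) • P - 1) * ((2 : ℂ) • P - 1) = 1 := by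
      simp only [sub_mul, mul_sub, smul_mul_smul_comm, hP.isIdempotentElem.eq, mul_one, one_mul]
      module
    exact Unitary.mem_iff.mpr ⟨by rw [hs, hm], by rw [hs, hm]⟩
  have hXR : X * P - P * X = X * ((2 : ℂ) • P - 1) := by
    have : X * ((2 : ℂ) • P - 1) = (2 : ℂ) • (X * P) - X := by
      rw [mul_sub, mul_smul_comm, mul_one]
    rw [this]
    nth_rw 4 [hX.2]
    module
  have h2 : deriv (geodesic P X) t = NormedSpace.exp (t • (Complex.I • X)) *
      (Complex.I • (X * ((2 : ℂ) • P - 1))) * star (NormedSpace.exp (t • (Complex.I • X))) := by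
    rw [show geodesic P X = _ from funext (geodesic_eq P X)]
    refine h1.deriv.trans ?_
    rw [← hXR, star_exp_smul_I_smul hX.1, smul_sub, ← smul_mul_assoc, ← mul_smul_comm]
    noncomm_ring
  rw [h2, CStarRing.norm_mul_mem_unitary _ (Unitary.star_mem hU), CStarRing.norm_mem_unitary_mul _ hU,
    norm_smul, CStarRing.norm_mul_mem_unitary _ hR]
  simp

theorem isGrassmannCurve_geodesic {P X : E →L[ℂ] E} (hP : IsStarProjection P)
    (hX : IsSelfAdjoint X) : IsGrassmannCurve P (geodesic P X 1) (geodesic P X) where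
  piecewiseSmooth := (contDiff_geodesic P X).isPiecewiseSmooth
  mem t _ := isStarProjection_geodesic hP hX t
  source := by simp [geodesic_eq]
  target := rfl

theorem ContinuousLinearMap.exp_apply_of_apply_eq_smul {T : E →L[ℂ] E} {v : E} {μ : ℂ}
    (h : T v = μ • v) : NormedSpace.exp T v = Complex.exp μ • v := by
  have hpow : ∀ n : ℕ, (T ^ n) v = μ ^ n • v := by
    intro n
    induction n with
    | zero => simp
    | succ n ih => rw [pow_succ', mul_apply_eq_comp, ih, map_smul, h, smul_smul, pow_succ]
  have h1 := (NormedSpace.exp_series_hasSum_exp' (𝕂 := ℂ) T).mapL (ContinuousLinearMap.apply ℂ E v)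
  have h2 := (NormedSpace.exp_series_hasSum_exp' (𝕂 := ℂ) μ).smul_const v
  rw [Complex.exp_eq_exp_ℂ]
  refine h1.unique (h2.congr_fun fun n => ?_)
  simp [hpow, smul_smul]

/-- The vectors `ξ ± η` are mapped by `X` to `±d` times themselves. -/
theorem exp_apply_of_interchange {X : E →L[ℂ] E} {d : ℝ} {ξ η : E} (h1 : X ξ = (d : ℂ) • η)
    (h2 : X η = (d : ℂ) • ξ) (z : ℂ) :
    NormedSpace.exp ((Complex.I * z) • X) ξ =
      Complex.cos (z * d) • ξ + (Complex.I * Complex.sin (z * d)) • η := by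
  have hp := ContinuousLinearMap.exp_apply_of_apply_eq_smul
    (T := (Complex.I * z) • X) (v := ξ + η) (μ := z * d * Complex.I)
    (by rw [smul_apply, map_add, h1, h2]; module)
  have hm := ContinuousLinearMap.exp_apply_of_apply_eq_smul
    (T := (Complex.I * z) • X) (v := ξ - η) (μ := -(z * d) * Complex.I)
    (by rw [smul_apply, map_sub, h1, h2]; module)
  have : ξ = (1 / 2 : ℂ) • (ξ + η) + (1 / 2 : ℂ) • (ξ - η) := by module
  conv_lhs => rw [this]
  rw [map_add, map_smul, map_smul, hp, hm, Complex.exp_mul_I, Complex.exp_mul_I, Complex.cos_neg,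
    Complex.sin_neg]
  module

namespace IsPrincipalPair

variable {P X : E →L[ℂ] E} {d : ℝ} {ξ η : E}

theorem geodesic_apply_left (h : IsPrincipalPair P X d ξ η) (t : ℝ) :
    geodesic P X t ξ = (Real.cos (t * d) : ℂ) •
      ((Real.cos (t * d) : ℂ) • ξ + (Complex.I * Real.sin (t * d)) • η) := by
  have e := exp_apply_of_interchange h.map_left h.map_right (-(t : ℂ))
  rw [mul_neg] at e
  rw [geodesic, mul_apply_eq_comp, mul_apply_eq_comp, e, map_add, map_smul,
    map_smul, h.proj_left, h.proj_right, smul_zero, add_zero, map_smul,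
    exp_apply_of_interchange h.map_left h.map_right, neg_mul, Complex.cos_neg]
  push_cast
  rfl

theorem geodesic_apply_right (h : IsPrincipalPair P X d ξ η) (t : ℝ) :
    geodesic P X t η = (-Complex.I * Real.sin (t * d)) •
      ((Real.cos (t * d) : ℂ) • ξ + (Complex.I * Real.sin (t * d)) • η) := by
  have e := exp_apply_of_interchange h.map_right h.map_left (-(t : ℂ))
  rw [mul_neg] at e
  rw [geodesic, mul_apply_eq_comp, mul_apply_eq_comp, e, map_add, map_smul,
    map_smul, h.proj_left, h.proj_right, smul_zero, zero_add, map_smul,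
    exp_apply_of_interchange h.map_left h.map_right, neg_mul, Complex.sin_neg]
  push_cast
  congr 1
  ring

end IsPrincipalPair

end Geodesic

/-! ### Lower length bound and rigidity on a principal pair. -/

section Rigidity

variable {E : Type*} [NormedAddCommGroup E] [InnerProductSpace ℂ E] [CompleteSpace E]

theorem IsGrassmannCurve.abs_arccos_sub_arccos_le_of_hasSpeedLE {P Q : E →L[ℂ] E}
    {β : ℝ → E →L[ℂ] E} (h : IsGrassmannCurve P Q β) {c : ℝ} (hc : HasSpeedLE β c) {v : E}
    (hv : ‖v‖ = 1) {s t : ℝ} (hs : s ∈ Set.Icc (0 : ℝ) 1) (ht : t ∈ Set.Icc (0 : ℝ) 1) :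
    |Real.arccos (2 * (inner ℂ (β t v) v).re - 1) - Real.arccos (2 * (inner ℂ (β s v) v).re - 1)|
      ≤ 2 * (c * |t - s|) := by
  wlog hst : s ≤ t generalizing s t
  · rw [abs_sub_comm, abs_sub_comm t s]
    exact this ht hs (le_of_not_ge hst)
  refine (h.abs_arccos_sub_arccos_le hv hs.1 hst ht.2).trans ?_
  rw [abs_of_nonneg (sub_nonneg.mpr hst)]
  gcongr
  exact hc.integral_le h.piecewiseSmooth hs.1 hst ht.2

/-- At time `s` the doubled angle of `v` is `0`; by time `t` it has grown to at most `2c|t - s|`. -/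
theorem IsGrassmannCurve.cos_le_of_apply_eq_self {P Q : E →L[ℂ] E} {β : ℝ → E →L[ℂ] E}
    (h : IsGrassmannCurve P Q β) {c : ℝ} (hc : HasSpeedLE β c) {v : E} (hv : ‖v‖ = 1) {s t : ℝ}
    (hs : s ∈ Set.Icc (0 : ℝ) 1) (ht : t ∈ Set.Icc (0 : ℝ) 1) (hvs : β s v = v)
    (hle : 2 * (c * |t - s|) ≤ Real.pi) :
    Real.cos (2 * (c * |t - s|)) ≤ 2 * (inner ℂ (β t v) v).re - 1 := by
  have h1 := h.abs_arccos_sub_arccos_le_of_hasSpeedLE hc hv hs ht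
  have h0 : 2 * (inner ℂ (β s v) v).re - 1 = 1 := by
    rw [(h.mem s hs).re_inner_apply_self, hvs, hv]; norm_num
  rw [h0, Real.arccos_one, sub_zero, abs_of_nonneg (Real.arccos_nonneg _)] at h1
  obtain ⟨h2, h3⟩ := abs_le.mp
    (IsStarProjection.abs_two_mul_re_inner_sub_one_le (h.mem t ht) hv)
  rw [← Real.cos_arccos h2 h3]
  exact Real.cos_le_cos_of_nonneg_of_le_pi (Real.arccos_nonneg _) hle h1

/-- Here the doubled angle starts at `π`. -/
theorem IsGrassmannCurve.le_neg_cos_of_apply_eq_zero {P Q : E →L[ℂ] E} {β : ℝ → E →L[ℂ] E}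
    (h : IsGrassmannCurve P Q β) {c : ℝ} (hc : HasSpeedLE β c) {v : E} (hv : ‖v‖ = 1) {s t : ℝ}
    (hs : s ∈ Set.Icc (0 : ℝ) 1) (ht : t ∈ Set.Icc (0 : ℝ) 1) (hvs : β s v = 0)
    (hle : 2 * (c * |t - s|) ≤ Real.pi) :
    2 * (inner ℂ (β t v) v).re - 1 ≤ -Real.cos (2 * (c * |t - s|)) := by
  have h1 := h.abs_arccos_sub_arccos_le_of_hasSpeedLE hc hv hs ht
  have h0 : 2 * (inner ℂ (β s v) v).re - 1 = -1 := by
    rw [hvs, inner_zero_left]; norm_num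
  rw [h0, Real.arccos_neg_one] at h1
  obtain ⟨h2, h3⟩ := abs_le.mp
    (IsStarProjection.abs_two_mul_re_inner_sub_one_le (h.mem t ht) hv)
  rw [← Real.cos_arccos h2 h3, ← Real.cos_pi_sub]
  exact Real.cos_le_cos_of_nonneg_of_le_pi (by linarith) (Real.arccos_le_pi _)
    (by linarith [(abs_le.mp h1).1])

theorem IsStarProjection.eq_of_one_le_re_inner_sub {T : E →L[ℂ] E} (hT : IsStarProjection T)
    {v w : E} (hv : ‖v‖ = 1)
    (h : 1 ≤ (inner ℂ (T v) v).re - (inner ℂ (T w) w).re) : T v = v ∧ T w = 0 := by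
  have h1 := hT.norm_sq_add_norm_sq v
  rw [hT.re_inner_apply_self, hT.re_inner_apply_self] at h
  rw [hv] at h1
  constructor
  · have : ‖v - T v‖ ^ 2 = 0 := by nlinarith [sq_nonneg ‖v - T v‖, sq_nonneg ‖T w‖]
    rw [sq_eq_zero_iff, norm_eq_zero, sub_eq_zero] at this
    exact this.symm
  · have : ‖T w‖ ^ 2 = 0 := by nlinarith [sq_nonneg ‖v - T v‖, sq_nonneg ‖T w‖]
    rwa [sq_eq_zero_iff, norm_eq_zero] at this

/-- The point is that this difference is a pure sinusoid in `2θ`, so its values at two angles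
determine it at every angle in between. -/
theorem IsSelfAdjoint.re_inner_rotation_sub {T : E →L[ℂ] E} (hT : IsSelfAdjoint T) (ξ η : E)
    (θ : ℝ) :
    (inner ℂ (T ((Real.cos θ : ℂ) • ξ + (Complex.I * Real.sin θ) • η))
        ((Real.cos θ : ℂ) • ξ + (Complex.I * Real.sin θ) • η)).re
      - (inner ℂ (T ((Real.cos θ : ℂ) • η + (Complex.I * Real.sin θ) • ξ))
        ((Real.cos θ : ℂ) • η + (Complex.I * Real.sin θ) • ξ)).re
      = ((inner ℂ (T ξ) ξ).re - (inner ℂ (T η) η).re) * Real.cos (2 * θ)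
        - 2 * (inner ℂ (T ξ) η).im * Real.sin (2 * θ) := by
  have h1 : inner ℂ (T η) ξ = (starRingEnd ℂ) (inner ℂ (T ξ) η) := by
    rw [inner_conj_symm]
    exact ContinuousLinearMap.isSelfAdjoint_iff_isSymmetric.mp hT _ _
  simp only [map_add, map_smul, inner_add_left, inner_add_right, inner_smul_left,
    inner_smul_right, h1, map_mul, Complex.conj_I, Complex.conj_ofReal, Complex.add_re, Complex.add_im,
    Complex.mul_re, Complex.mul_im, Complex.I_re, Complex.I_im, Complex.ofReal_re,
    Complex.ofReal_im, Complex.neg_re, Complex.neg_im, Complex.conj_re, Complex.conj_im,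
    Real.sin_two_mul, Real.cos_two_mul']
  ring

namespace IsPrincipalPair

variable {P X : E →L[ℂ] E} {d : ℝ} {ξ η : E}

theorem geodesic_apply_rotation_left (h : IsPrincipalPair P X d ξ η) (t : ℝ) :
    geodesic P X t ((Real.cos (t * d) : ℂ) • ξ + (Complex.I * Real.sin (t * d)) • η) =
      (Real.cos (t * d) : ℂ) • ξ + (Complex.I * Real.sin (t * d)) • η := by
  rw [map_add, map_smul, map_smul, h.geodesic_apply_left, h.geodesic_apply_right, smul_smul,
    smul_smul, ← add_smul]
  refine Eq.trans ?_ (one_smul ℂ _)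
  congr 1
  have := Complex.cos_sq_add_sin_sq ((t * d : ℝ) : ℂ)
  push_cast at this ⊢
  linear_combination this - Complex.sin (t * d) ^ 2 * Complex.I_sq

theorem geodesic_apply_rotation_right (h : IsPrincipalPair P X d ξ η) (t : ℝ) :
    geodesic P X t ((Real.cos (t * d) : ℂ) • η + (Complex.I * Real.sin (t * d)) • ξ) = 0 := by
  rw [map_add, map_smul, map_smul, h.geodesic_apply_left, h.geodesic_apply_right, smul_smul,
    smul_smul, ← add_smul]
  convert zero_smul ℂ _ using 2
  ring

/-- The doubled angle of `ξ` has to go from `0` to `2d`. -/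
theorem le_curveLength (h : IsPrincipalPair P X d ξ η) (hd : d ∈ Set.Icc 0 (Real.pi / 2))
    (hP : IsStarProjection P) {β : ℝ → E →L[ℂ] E} (hX : IsSelfAdjoint X)
    (hβ : IsGrassmannCurve P (geodesic P X 1) β) : d ≤ curveLength β := by
  have h1 := hβ.abs_arccos_sub_arccos_le h.norm_left le_rfl zero_le_one le_rfl
  have e0 : 2 * (inner ℂ (β 0 ξ) ξ).re - 1 = 1 := by
    rw [hβ.source, hP.re_inner_apply_self, h.proj_left, h.norm_left]; norm_num
  have e1 : 2 * (inner ℂ (β 1 ξ) ξ).re - 1 = Real.cos (2 * d) := by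
    rw [hβ.target, (isStarProjection_geodesic hP hX 1).re_inner_apply_self, h.geodesic_apply_left,
      norm_smul, h.norm_rotation_left, Complex.norm_real, mul_one, Real.norm_eq_abs, sq_abs,
      one_mul, Real.cos_two_mul]
  rw [e0, e1, Real.arccos_one, sub_zero, Real.arccos_cos (by linarith [hd.1]) (by linarith [hd.2]),
    abs_of_nonneg (by linarith [hd.1])] at h1
  exact le_of_mul_le_mul_left h1 two_pos

/-- Let `φ(θ)` be the sinusoid of `IsSelfAdjoint.re_inner_rotation_sub` for `T = β t`. The start of
the curve bounds `φ(0)` below by `cos 2td`, and its end bounds `φ(d)` below by `cos 2(1-t)d`.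
Interpolation yields `φ(td) ≥ 1`, the extreme value, which forces `β t` to fix the rotated `ξ` and
to kill the rotated `η`, as the geodesic does. -/
theorem apply_eq_geodesic_apply (h : IsPrincipalPair P X d ξ η) (hd : d ∈ Set.Ioo 0 (Real.pi / 2))
    {β : ℝ → E →L[ℂ] E} (hβ : IsGrassmannCurve P (geodesic P X 1) β) (hs : HasSpeedLE β d)
    {t : ℝ} (ht : t ∈ Set.Icc (0 : ℝ) 1) :
    β t ξ = geodesic P X t ξ ∧ β t η = geodesic P X t η := by
  have h0 : (0 : ℝ) ∈ Set.Icc (0 : ℝ) 1 := by simp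
  have h1 : (1 : ℝ) ∈ Set.Icc (0 : ℝ) 1 := by simp
  obtain ⟨hd0, hd2⟩ := hd
  have hT : IsStarProjection (β t) := hβ.mem t ht
  have l0 : 2 * (d * |t - 0|) ≤ Real.pi := by
    rw [sub_zero, abs_of_nonneg ht.1]; nlinarith [ht.2]
  have l1 : 2 * (d * |t - 1|) ≤ Real.pi := by
    rw [abs_sub_comm, abs_of_nonneg (by linarith [ht.2])]; nlinarith [ht.1]
  have a1 := hβ.cos_le_of_apply_eq_self hs h.norm_left h0 ht (by rw [hβ.source, h.proj_left]) l0
  have a2 := hβ.le_neg_cos_of_apply_eq_zero hs h.norm_right h0 ht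
    (by rw [hβ.source, h.proj_right]) l0
  have b1 := hβ.cos_le_of_apply_eq_self hs (h.norm_rotation_left (1 * d)) h1 ht
    (by rw [hβ.target, h.geodesic_apply_rotation_left]) l1
  have b2 := hβ.le_neg_cos_of_apply_eq_zero hs (h.norm_rotation_right (1 * d)) h1 ht
    (by rw [hβ.target, h.geodesic_apply_rotation_right]) l1
  have r1 := hT.isSelfAdjoint.re_inner_rotation_sub ξ η (1 * d)
  have rt := hT.isSelfAdjoint.re_inner_rotation_sub ξ η (t * d)
  rw [sub_zero, abs_of_nonneg ht.1] at a1 a2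
  rw [abs_sub_comm, abs_of_nonneg (by linarith [ht.2])] at b1 b2
  have key : 1 ≤ (inner ℂ (β t ((Real.cos (t * d) : ℂ) • ξ + (Complex.I * Real.sin (t * d)) • η))
        ((Real.cos (t * d) : ℂ) • ξ + (Complex.I * Real.sin (t * d)) • η)).re
      - (inner ℂ (β t ((Real.cos (t * d) : ℂ) • η + (Complex.I * Real.sin (t * d)) • ξ))
        ((Real.cos (t * d) : ℂ) • η + (Complex.I * Real.sin (t * d)) • ξ)).re := by
    rw [rt]
    set m := (inner ℂ (β t ξ) ξ).re - (inner ℂ (β t η) η).re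
    set r := (inner ℂ (β t ξ) η).im
    have k0 : Real.cos (2 * (t * d)) ≤ m := by
      simp only [m]; rw [mul_comm t d]; linarith
    have k1 : Real.cos (2 * ((1 - t) * d)) ≤
        m * Real.cos (2 * d) - 2 * r * Real.sin (2 * d) := by
      rw [one_mul] at r1 b1 b2; rw [mul_comm (1 - t) d]; linarith
    have s0 : 0 < Real.sin (2 * d) := Real.sin_pos_of_pos_of_lt_pi (by linarith) (by linarith)
    have sa : 0 ≤ Real.sin (2 * (t * d)) :=
      Real.sin_nonneg_of_nonneg_of_le_pi (by nlinarith [ht.1]) (by nlinarith [ht.2])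
    have sb : 0 ≤ Real.sin (2 * ((1 - t) * d)) :=
      Real.sin_nonneg_of_nonneg_of_le_pi (by nlinarith [ht.2]) (by nlinarith [ht.1])
    have e : 2 * ((1 - t) * d) = 2 * d - 2 * (t * d) := by ring
    -- The two lower bounds, with the interpolation weights, add up to exactly `sin 2d`.
    have eab : Real.sin (2 * d) = Real.sin (2 * ((1 - t) * d)) * Real.cos (2 * (t * d)) +
        Real.cos (2 * ((1 - t) * d)) * Real.sin (2 * (t * d)) := by
      rw [← Real.sin_add]; congr 1; ring
    have q0 := mul_le_mul_of_nonneg_left k0 sb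
    have q1 := mul_le_mul_of_nonneg_left k1 sa
    -- Interpolation: `sin(2d) φ(td) = sin(2(1-t)d) φ(0) + sin(2td) φ(d)`. The weights are
    -- nonnegative because `2d < π`.
    have esum : Real.sin (2 * d) *
        (m * Real.cos (2 * (t * d)) - 2 * r * Real.sin (2 * (t * d))) =
        Real.sin (2 * ((1 - t) * d)) * m + Real.sin (2 * (t * d)) *
          (m * Real.cos (2 * d) - 2 * r * Real.sin (2 * d)) := by
      rw [e, Real.sin_sub]; ring
    refine le_of_mul_le_mul_left ?_ s0
    rw [esum, mul_one]
    linarith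
  obtain ⟨f1, f2⟩ := hT.eq_of_one_le_re_inner_sub (h.norm_rotation_left _) key
  have hcs := Complex.cos_sq_add_sin_sq ((t * d : ℝ) : ℂ)
  rw [h.geodesic_apply_left, h.geodesic_apply_right]
  set c : ℂ := (Real.cos (t * d) : ℂ) with hc
  set s : ℂ := (Real.sin (t * d) : ℂ) with hsn
  rw [← Complex.ofReal_cos, ← Complex.ofReal_sin, ← hc, ← hsn] at hcs
  -- Undo the rotation to recover `ξ` and `η`.
  have hξ : ξ = c • (c • ξ + (Complex.I * s) • η) + (-Complex.I * s) •
      (c • η + (Complex.I * s) • ξ) := by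
    match_scalars
    · linear_combination -hcs + s ^ 2 * Complex.I_sq
    · ring
  have hη : η = c • (c • η + (Complex.I * s) • ξ) + (-Complex.I * s) •
      (c • ξ + (Complex.I * s) • η) := by
    match_scalars
    · linear_combination -hcs + s ^ 2 * Complex.I_sq
    · ring
  constructor
  · conv_lhs => rw [hξ]
    rw [map_add, map_smul, map_smul, f1, f2, smul_zero, add_zero]
  · conv_lhs => rw [hη]
    rw [map_add, map_smul, map_smul, f1, f2, smul_zero, zero_add]

end IsPrincipalPair

end Rigidity

/-! ### Speed bounds under contractive linear maps. -/

section LinearContraction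

variable {A B C : Type*} [NormedAddCommGroup A] [NormedSpace ℝ A] [NormedAddCommGroup B]
  [NormedSpace ℝ B] [NormedAddCommGroup C] [NormedSpace ℝ C]

/-- A real linear map of norm at most one between normed spaces. -/
structure IsLinearContraction (G : A → B) : Prop where
  map_add (x y : A) : G (x + y) = G x + G y
  map_smul (c : ℝ) (x : A) : G (c • x) = c • G x
  norm_le (x : A) : ‖G x‖ ≤ ‖x‖

theorem IsLinearContraction.isBoundedLinearMap {G : A → B} (hG : IsLinearContraction G) :
    IsBoundedLinearMap ℝ G where
  map_add := hG.map_add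
  map_smul := hG.map_smul
  bound := ⟨1, one_pos, fun x => by rw [one_mul]; exact hG.norm_le x⟩

theorem IsLinearContraction.contDiff {G : A → B} (hG : IsLinearContraction G) : ContDiff ℝ ∞ G :=
  hG.isBoundedLinearMap.contDiff

theorem IsLinearContraction.isPiecewiseSmooth_comp {G : A → B} (hG : IsLinearContraction G)
    {δ : ℝ → A} (hδ : IsPiecewiseSmooth δ) : IsPiecewiseSmooth fun t => G (δ t) :=
  hδ.contDiff_comp (contDiff_const (c := (0 : ℝ))) (F := fun p => G p.2)
    (hG.contDiff.comp contDiff_snd)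

theorem IsLinearContraction.hasDerivAt_comp {G : A → B} (hG : IsLinearContraction G) {δ : ℝ → A}
    {D : A} {t : ℝ} (hδ : HasDerivAt δ D t) : HasDerivAt (fun s => G (δ s)) (G D) t :=
  hG.isBoundedLinearMap.toContinuousLinearMap.hasFDerivAt.comp_hasDerivAt t hδ

theorem IsLinearContraction.hasSpeedLE_comp {G : A → B} (hG : IsLinearContraction G) {δ : ℝ → A}
    (hδ : ContDiff ℝ ∞ δ) {c : ℝ} (hc : HasSpeedLE δ c) : HasSpeedLE (fun t => G (δ t)) c := by
  intro t ht _
  have hd := hδ.differentiable (by simp) t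
  rw [(hG.hasDerivAt_comp hd.hasDerivAt).deriv]
  exact (hG.norm_le _).trans (hc t ht hd)

/-- The block `α` is recovered from `δ` by `G`, so `α` is differentiable wherever `δ` is and its
speed bound applies there. -/
theorem IsLinearContraction.hasSpeedLE_block {F : B × C → A} (hF : IsLinearContraction F)
    {G : A → C} (hG : IsLinearContraction G) {δ : ℝ → A} {γ : ℝ → B} {α : ℝ → C} {c : ℝ}
    (hγ : ContDiff ℝ ∞ γ) (hγc : HasSpeedLE γ c) (hα : HasSpeedLE α c)
    (hδ : ∀ t ∈ Set.Icc (0 : ℝ) 1, δ t = F (γ t, α t)) (hGF : ∀ x y, G (F (x, y)) = y) :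
    HasSpeedLE δ c := by
  intro t ht hd
  have hev : δ =ᶠ[nhds t] fun s => F (γ s, α s) := by
    filter_upwards [Icc_mem_nhds ht.1 ht.2] with s hs using hδ s hs
  have hdγ := hγ.differentiable (by simp) t
  have hdα : DifferentiableAt ℝ α t := by
    refine (hG.hasDerivAt_comp hd.hasDerivAt).differentiableAt.congr_of_eventuallyEq ?_
    filter_upwards [hev] with s hs
    rw [hs, hGF]
  rw [hev.deriv_eq, (hF.hasDerivAt_comp (hdγ.hasDerivAt.prodMk hdα.hasDerivAt)).deriv]
  exact (hF.norm_le _).trans (max_le (hγc t ht hdγ) (hα t ht hdα))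

/-- The other block is smooth, so a corner of `δ` must be a corner of `G ∘ δ`; hence the bound on
`δ` covers every point where `G ∘ δ` is differentiable. -/
theorem IsLinearContraction.hasSpeedLE_of_block {F : B × C → A} (hF : IsLinearContraction F)
    {G : A → C} (hG : IsLinearContraction G) {δ : ℝ → A} {γ : ℝ → B} {c : ℝ}
    (hγ : ContDiff ℝ ∞ γ) (hc : HasSpeedLE δ c)
    (hδ : ∀ t ∈ Set.Icc (0 : ℝ) 1, δ t = F (γ t, G (δ t))) :
    HasSpeedLE (fun t => G (δ t)) c := by
  intro t ht hd
  have hd' : DifferentiableAt ℝ δ t := by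
    refine (hF.hasDerivAt_comp ((hγ.differentiable (by simp) t).hasDerivAt.prodMk
      hd.hasDerivAt)).differentiableAt.congr_of_eventuallyEq ?_
    filter_upwards [Icc_mem_nhds ht.1 ht.2] with s hs using hδ s hs
  rw [(hG.hasDerivAt_comp hd'.hasDerivAt).deriv]
  exact (hG.norm_le _).trans (hc t ht hd')

end LinearContraction

/-! ### Compressions and block diagonal operators. -/

section BlockDiag

theorem IsSelfAdjoint.map_orthogonal {E : Type*} [NormedAddCommGroup E]
    [InnerProductSpace ℂ E] [CompleteSpace E] {S : Submodule ℂ E} {T : E →L[ℂ] E} (hT : IsSelfAdjoint T)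
    (hS : ∀ x ∈ S, T x ∈ S) : ∀ x ∈ Sᗮ, T x ∈ Sᗮ := by
  intro x hx
  rw [Submodule.mem_orthogonal] at hx ⊢
  intro u hu
  rw [← hx (T u) (hS u hu)]
  exact (ContinuousLinearMap.isSelfAdjoint_iff_isSymmetric.mp hT u x).symm

variable {E : Type*} [NormedAddCommGroup E] [InnerProductSpace ℂ E]
variable (S : Submodule ℂ E) [S.HasOrthogonalProjection]

theorem coe_compression_apply (T : E →L[ℂ] E) (x : S) :
    (compression S T x : E) = S.starProjection (T x) := rfl

theorem coe_compression_apply_of_mem {T : E →L[ℂ] E} {x : S} (h : T x ∈ S) :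
    (compression S T x : E) = T x := by
  rw [coe_compression_apply, Submodule.starProjection_eq_self_iff.mpr h]

theorem norm_compression_le (T : E →L[ℂ] E) : ‖compression S T‖ ≤ ‖T‖ := by
  refine ContinuousLinearMap.opNorm_le_bound _ (norm_nonneg _) fun x => ?_
  rw [Submodule.coe_norm, coe_compression_apply]
  exact (S.norm_starProjection_apply_le _).trans (T.le_opNorm _)

theorem blockDiag_apply (A : S →L[ℂ] S) (B : Sᗮ →L[ℂ] Sᗮ) (v : E) :
    blockDiag S A B v = A (S.orthogonalProjectionOnto v) + B (Sᗮ.orthogonalProjectionOnto v) := rfl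

theorem blockDiag_apply_coe (A : S →L[ℂ] S) (B : Sᗮ →L[ℂ] Sᗮ) (x : S) :
    blockDiag S A B x = A x := by
  rw [blockDiag_apply, Submodule.orthogonalProjectionOnto_mem_subspace_eq_self,
    Submodule.orthogonalProjectionOnto_orthogonal_apply_eq_zero x.2]
  simp

theorem blockDiag_apply_coe_orthogonal (A : S →L[ℂ] S) (B : Sᗮ →L[ℂ] Sᗮ) (x : Sᗮ) :
    blockDiag S A B x = B x := by
  rw [blockDiag_apply, Submodule.orthogonalProjectionOnto_mem_subspace_eq_self,
    Submodule.orthogonalProjectionOnto_apply_of_mem_orthogonal x.2]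
  simp

theorem compression_orthogonal_blockDiag (A : S →L[ℂ] S) (B : Sᗮ →L[ℂ] Sᗮ) :
    compression Sᗮ (blockDiag S A B) = B := by
  ext x
  rw [coe_compression_apply_of_mem] <;> rw [blockDiag_apply_coe_orthogonal]
  exact (B x).2

variable {S}

theorem ContinuousLinearMap.ext_orthogonal {T T' : E →L[ℂ] E} (h : ∀ x ∈ S, T x = T' x)
    (h' : ∀ x ∈ Sᗮ, T x = T' x) : T = T' := by
  ext v
  rw [← S.starProjection_add_starProjection_orthogonal v, map_add, map_add,
    h _ (S.starProjection_apply_mem v), h' _ (Sᗮ.starProjection_apply_mem v)]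

theorem blockDiag_compression [CompleteSpace E] {T : E →L[ℂ] E} (hT : IsSelfAdjoint T)
    (hS : ∀ x ∈ S, T x ∈ S) : blockDiag S (compression S T) (compression Sᗮ T) = T := by
  refine ContinuousLinearMap.ext_orthogonal (S := S) (fun x hx => ?_) (fun x hx => ?_)
  · lift x to S using hx
    rw [blockDiag_apply_coe, coe_compression_apply_of_mem _ (hS x x.2)]
  · lift x to Sᗮ using hx
    rw [blockDiag_apply_coe_orthogonal,
      coe_compression_apply_of_mem _ (hT.map_orthogonal hS x x.2)]

theorem norm_blockDiag_le {A : S →L[ℂ] S} {B : Sᗮ →L[ℂ] Sᗮ} {c : ℝ} (hA : ‖A‖ ≤ c)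
    (hB : ‖B‖ ≤ c) : ‖blockDiag S A B‖ ≤ c := by
  have hc : 0 ≤ c := le_trans (norm_nonneg A) hA
  refine ContinuousLinearMap.opNorm_le_bound _ hc fun v => ?_
  have h1 := norm_add_sq_eq_norm_sq_add_norm_sq_of_inner_eq_zero (𝕜 := ℂ)
    (A (S.orthogonalProjectionOnto v) : E) (B (Sᗮ.orthogonalProjectionOnto v) : E)
    (Submodule.inner_right_of_mem_orthogonal (Submodule.coe_mem _) (Submodule.coe_mem _))
  have h2 := S.norm_sq_eq_add_norm_sq_projection v
  have hA' := (A.le_opNorm (S.orthogonalProjectionOnto v)).trans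
    (mul_le_mul_of_nonneg_right hA (norm_nonneg _))
  have hB' := (B.le_opNorm (Sᗮ.orthogonalProjectionOnto v)).trans
    (mul_le_mul_of_nonneg_right hB (norm_nonneg _))
  rw [blockDiag_apply]
  refine (pow_le_pow_iff_left₀ (norm_nonneg _) (by positivity) two_ne_zero).mp ?_
  have hA2 := pow_le_pow_left₀ (norm_nonneg _) hA' 2
  have hB2 := pow_le_pow_left₀ (norm_nonneg _) hB' 2
  rw [mul_pow, h2]
  rw [mul_pow] at hA2 hB2
  simp only [Submodule.coe_norm] at h1 hA2 hB2 ⊢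
  nlinarith

theorem isLinearContraction_compression : IsLinearContraction
    (compression S : (E →L[ℂ] E) → (S →L[ℂ] S)) where
  map_add T T' := by simp [compression]
  map_smul c T := by
    ext x
    simp only [coe_compression_apply, smul_apply]
    rw [Submodule.coe_smul_of_tower, coe_compression_apply, ← Complex.coe_smul, map_smul,
      Complex.coe_smul]
  norm_le := norm_compression_le S

theorem isLinearContraction_blockDiag : IsLinearContraction
    fun p : (S →L[ℂ] S) × (Sᗮ →L[ℂ] Sᗮ) => blockDiag S p.1 p.2 where
  map_add p q := by
    ext x
    simp only [blockDiag_apply, add_apply, Prod.fst_add, Prod.snd_add, Submodule.coe_add]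
    abel
  map_smul c p := by
    ext x
    rw [smul_apply, blockDiag_apply, blockDiag_apply, smul_add]
    rfl
  norm_le p := norm_blockDiag_le (norm_fst_le p) (norm_snd_le p)

theorem isStarProjection_compression [CompleteSpace E] [CompleteSpace S] {T : E →L[ℂ] E}
    (hT : IsStarProjection T) (hS : ∀ x ∈ S, T x ∈ S) : IsStarProjection (compression S T) := by
  constructor
  · ext x
    have h1 : (compression S T x : E) = T x := coe_compression_apply_of_mem S (hS x x.2)
    rw [mul_apply_eq_comp, coe_compression_apply_of_mem S (hS _ (Submodule.coe_mem _)), h1]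
    exact congr($(hT.isIdempotentElem.eq) (x : E))
  · rw [ContinuousLinearMap.isSelfAdjoint_iff_isSymmetric]
    intro x y
    change inner ℂ (compression S T x : E) (y : E) = inner ℂ (x : E) (compression S T y : E)
    rw [coe_compression_apply_of_mem _ (hS x x.2), coe_compression_apply_of_mem _ (hS y y.2)]
    exact ContinuousLinearMap.isSelfAdjoint_iff_isSymmetric.mp hT.isSelfAdjoint _ _

theorem isStarProjection_blockDiag [CompleteSpace E] [CompleteSpace S] {A : S →L[ℂ] S}
    {B : Sᗮ →L[ℂ] Sᗮ} (hA : IsStarProjection A) (hB : IsStarProjection B) :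
    IsStarProjection (blockDiag S A B) := by
  constructor
  · refine ContinuousLinearMap.ext_orthogonal (S := S) (fun x hx => ?_) (fun x hx => ?_)
    · lift x to S using hx
      rw [mul_apply_eq_comp, blockDiag_apply_coe, blockDiag_apply_coe]
      exact congr(($(hA.isIdempotentElem.eq) x : E))
    · lift x to Sᗮ using hx
      rw [mul_apply_eq_comp, blockDiag_apply_coe_orthogonal,
        blockDiag_apply_coe_orthogonal]
      exact congr(($(hB.isIdempotentElem.eq) x : E))
  · rw [IsSelfAdjoint, ContinuousLinearMap.star_eq_adjoint, blockDiag, map_add,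
      ContinuousLinearMap.adjoint_comp, ContinuousLinearMap.adjoint_comp,
      ContinuousLinearMap.adjoint_comp, ContinuousLinearMap.adjoint_comp,
      Submodule.adjoint_subtypeL, Submodule.adjoint_orthogonalProjectionOnto,
      Submodule.adjoint_subtypeL, Submodule.adjoint_orthogonalProjectionOnto,
      ← ContinuousLinearMap.star_eq_adjoint, ← ContinuousLinearMap.star_eq_adjoint,
      hA.isSelfAdjoint.star_eq, hB.isSelfAdjoint.star_eq, ContinuousLinearMap.comp_assoc,
      ContinuousLinearMap.comp_assoc]

end BlockDiag

/-! ### The subspace `S_X` and its principal pairs. -/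

section MaxSubspace

variable {E : Type*} [NormedAddCommGroup E] [InnerProductSpace ℂ E] [CompleteSpace E]

theorem spectrum_abs_subset (X : E →L[ℂ] E) :
    spectrum ℝ (CFC.abs X) ⊆ Set.Icc 0 ‖X‖ := by
  intro a ha
  refine ⟨spectrum_nonneg_of_nonneg (CFC.abs_nonneg X) ha, (Real.le_norm_self a).trans ?_⟩
  have h := spectrum.norm_le_norm_mul_of_mem ha
  rw [CFC.norm_abs] at h
  exact h.trans (mul_le_of_le_one_right (norm_nonneg _) ContinuousLinearMap.norm_id_le)

/-- If `‖X‖ = 0`, the spectrum lies in `[0, 0]`. -/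
theorem norm_pos_of_nontrivial_spectrum_abs {X : E →L[ℂ] E}
    (h : (spectrum ℝ (CFC.abs X)).Nontrivial) : 0 < ‖X‖ := by
  obtain ⟨a, ha, b, hb, hab⟩ := h
  have ha' := spectrum_abs_subset X ha
  have hb' := spectrum_abs_subset X hb
  refine lt_of_le_of_ne (norm_nonneg _) fun h0 => hab ?_
  rw [← h0] at ha' hb'
  linarith [ha'.1, ha'.2, hb'.1, hb'.2]

theorem mem_maxSubspace_iff_abs {X : E →L[ℂ] E} {v : E} :
    v ∈ maxSubspace X ↔ CFC.abs X v = (‖X‖ : ℂ) • v := by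
  rw [maxSubspace, LinearMap.mem_ker]
  change (‖X‖ : ℂ) • v - CFC.abs X v = 0 ↔ _
  rw [sub_eq_zero, eq_comm]

/-- This replaces `|X|` by `X² = |X|²`, which is easier to commute with `X` and `P`. -/
theorem mem_maxSubspace_iff {X : E →L[ℂ] E} (hX : IsSelfAdjoint X) (h0 : 0 < ‖X‖) {v : E} :
    v ∈ maxSubspace X ↔ X (X v) = ((‖X‖ ^ 2 : ℝ) : ℂ) • v := by
  have hsq : ∀ w, CFC.abs X (CFC.abs X w) = X (X w) := fun w => by
    have := CFC.abs_mul_abs X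
    rw [hX.star_eq] at this
    exact congr($this w)
  rw [mem_maxSubspace_iff_abs]
  constructor
  · intro h
    rw [← hsq, h, map_smul, h, smul_smul]
    push_cast
    rw [sq]
  · intro h
    -- Factoring `|X|² - ‖X‖²` shows `|X|w = -‖X‖w`; positivity of `|X|` then forces `w = 0`.
    set w := CFC.abs X v - (‖X‖ : ℂ) • v with hw
    have hw1 : CFC.abs X w = -((‖X‖ : ℂ) • w) := by
      rw [hw, map_sub, hsq, h, map_smul]
      push_cast
      module
    have hpos := ((ContinuousLinearMap.nonneg_iff_isPositive _).mp
      (CFC.abs_nonneg X)).re_inner_nonneg_left w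
    rw [hw1, inner_neg_left, inner_smul_left, inner_self_eq_norm_sq_to_K] at hpos
    have h3 : ‖X‖ * ‖w‖ ^ 2 ≤ 0 := by
      have e : RCLike.re (-((starRingEnd ℂ) (‖X‖ : ℂ) * ((‖w‖ : ℝ) : ℂ) ^ 2)) =
          -(‖X‖ * ‖w‖ ^ 2) := by
        rw [Complex.conj_ofReal, ← Complex.ofReal_pow, ← Complex.ofReal_mul, ← Complex.ofReal_neg]
        exact Complex.ofReal_re _
      have := hpos.trans_eq e
      linarith
    have h4 : ‖w‖ ^ 2 = 0 := le_antisymm (by by_contra! hc; nlinarith) (sq_nonneg _)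
    rw [sq_eq_zero_iff, norm_eq_zero] at h4
    exact sub_eq_zero.mp h4

/-- The norm of a positive operator lies in its spectrum, and in finite dimension spectral values
are eigenvalues. -/
theorem exists_ne_zero_mem_maxSubspace [FiniteDimensional ℂ E] {X : E →L[ℂ] E}
    (h0 : 0 < ‖X‖) : ∃ v ∈ maxSubspace X, v ≠ 0 := by
  by_contra! hbot
  have : Nontrivial (E →L[ℂ] E) := ⟨X, 0, norm_pos_iff.mp h0⟩
  have hs : ‖X‖ ∈ spectrum ℝ (CFC.abs X) := by
    rw [← CFC.norm_abs]
    exact CStarAlgebra.norm_mem_spectrum_of_nonneg (CFC.abs_nonneg X)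
  refine hs ?_
  have hinj : Function.Injective (algebraMap ℝ (E →L[ℂ] E) ‖X‖ - CFC.abs X) := by
    refine (injective_iff_map_eq_zero _).mpr fun v hv => hbot v ?_
    rw [mem_maxSubspace_iff_abs, Complex.coe_smul]
    rw [sub_apply, sub_eq_zero, Algebra.algebraMap_eq_smul_one] at hv
    exact hv.symm
  exact ContinuousLinearMap.isUnit_iff_bijective.mpr
    ⟨hinj, (LinearMap.injective_iff_surjective (f := (algebraMap ℝ (E →L[ℂ] E) ‖X‖ -
      CFC.abs X).toLinearMap)).mp hinj⟩

variable {P X : E →L[ℂ] E}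

theorem map_mem_maxSubspace (hX : IsSelfAdjoint X) (h0 : 0 < ‖X‖) {v : E}
    (hv : v ∈ maxSubspace X) : X v ∈ maxSubspace X := by
  rw [mem_maxSubspace_iff hX h0] at hv ⊢
  rw [hv, map_smul]

theorem IsTangentAt.proj_apply (hX : IsTangentAt P X) (v : E) : P (X v) = X v - X (P v) := by
  have : X v = P (X v) + X (P v) := congr($(hX.2) v)
  exact eq_sub_of_add_eq this.symm

/-- From `PX = X - XP`, applied twice, `P` commutes with `X²`. -/
theorem IsTangentAt.proj_mem_maxSubspace (hX : IsTangentAt P X) (h0 : 0 < ‖X‖) {v : E}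
    (hv : v ∈ maxSubspace X) : P v ∈ maxSubspace X := by
  rw [mem_maxSubspace_iff hX.1 h0] at hv ⊢
  have h := hX.proj_apply (X v)
  rw [hX.proj_apply v, map_sub, hv, map_smul] at h
  rw [h]
  abel

theorem IsStarProjection.isPrincipalPair (hP : IsStarProjection P) {ξ η : E} (hξ : ‖ξ‖ = 1) (hη : ‖η‖ = 1) (hPξ : P ξ = ξ) (hPη : P η = 0)
    (h1 : X ξ = (‖X‖ : ℂ) • η) (h2 : X η = (‖X‖ : ℂ) • ξ) : IsPrincipalPair P X ‖X‖ ξ η where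
  map_left := h1
  map_right := h2
  proj_left := hPξ
  proj_right := hPη
  norm_left := hξ
  norm_right := hη
  inner_eq_zero := by
    have := ContinuousLinearMap.isSelfAdjoint_iff_isSymmetric.mp hP.isSelfAdjoint ξ η
    simp only [ContinuousLinearMap.coe_coe] at this
    rw [← hPξ, this, hPη, inner_zero_right]

/-- The partner of the normalized vector `u` is `Xu/‖X‖`: codiagonality moves it to the other side
of `P`, and `X² = ‖X‖²` on `S_X` makes it a unit vector that `X` sends back. -/
theorem IsTangentAt.exists_isPrincipalPair (hP : IsStarProjection P) (hX : IsTangentAt P X)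
    (h0 : 0 < ‖X‖) {v : E} (hv : v ∈ maxSubspace X) (hv0 : v ≠ 0) :
    (P v = v → ∃ ξ η, IsPrincipalPair P X ‖X‖ ξ η ∧ ξ ∈ maxSubspace X ∧ η ∈ maxSubspace X ∧
      v = (‖v‖ : ℂ) • ξ) ∧
    (P v = 0 → ∃ ξ η, IsPrincipalPair P X ‖X‖ ξ η ∧ ξ ∈ maxSubspace X ∧ η ∈ maxSubspace X ∧
      v = (‖v‖ : ℂ) • η) := by
  have hd : (‖X‖ : ℂ) ≠ 0 := by exact_mod_cast h0.ne'
  have hn : (‖v‖ : ℂ) ≠ 0 := by exact_mod_cast norm_ne_zero_iff.mpr hv0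
  set u : E := (‖v‖ : ℂ)⁻¹ • v with hu
  set w : E := (‖X‖ : ℂ)⁻¹ • X u with hw
  have huS : u ∈ maxSubspace X := Submodule.smul_mem _ _ hv
  have hwS : w ∈ maxSubspace X := Submodule.smul_mem _ _ (map_mem_maxSubspace hX.1 h0 huS)
  have hvu : v = (‖v‖ : ℂ) • u := by rw [hu, smul_smul, mul_inv_cancel₀ hn, one_smul]
  have hu1 : ‖u‖ = 1 := by
    rw [hu, norm_smul, norm_inv, Complex.norm_real, norm_norm,
      inv_mul_cancel₀ (norm_ne_zero_iff.mpr hv0)]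
  have hXu : X u = (‖X‖ : ℂ) • w := by rw [hw, smul_smul, mul_inv_cancel₀ hd, one_smul]
  have hXw : X w = (‖X‖ : ℂ) • u := by
    rw [hw, map_smul, (mem_maxSubspace_iff hX.1 h0).mp huS, smul_smul]
    congr 1
    push_cast
    field_simp
  have hw1 : ‖w‖ = 1 := by
    clear_value w
    have h1 : inner ℂ (X u) w = inner ℂ u (X w) :=
      ContinuousLinearMap.isSelfAdjoint_iff_isSymmetric.mp hX.1 u w
    rw [hXu, hXw, inner_smul_left, inner_smul_right, Complex.conj_ofReal, mul_right_inj' hd,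
      inner_self_eq_norm_sq_to_K, inner_self_eq_norm_sq_to_K, hu1] at h1
    have h2 : ‖w‖ ^ 2 = 1 := by
      have : ((‖w‖ ^ 2 : ℝ) : ℂ) = ((1 : ℝ) : ℂ) := by push_cast; simpa using h1
      exact_mod_cast this
    exact (pow_eq_one_iff_of_nonneg (norm_nonneg _) two_ne_zero).mp h2
  constructor
  · intro hPv
    have hPu : P u = u := by rw [hu, map_smul, hPv]
    have hPw : P w = 0 := by rw [hw, map_smul, hX.proj_apply, hPu, sub_self, smul_zero]
    exact ⟨u, w, hP.isPrincipalPair hu1 hw1 hPu hPw hXu hXw, huS, hwS, hvu⟩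
  · intro hPv
    have hPu : P u = 0 := by rw [hu, map_smul, hPv, smul_zero]
    have hPw : P w = w := by rw [hw, map_smul, hX.proj_apply, hPu, map_zero, sub_zero]
    exact ⟨w, u, hP.isPrincipalPair hw1 hu1 hPw hPu hXw hXu, hwS, huS, hvu⟩

/-- Induction principle for `S_X`: split `v` as `Pv + (v - Pv)`; each nonzero part is a multiple of
a member of a principal pair. -/
theorem maxSubspace_le_of_isPrincipalPair (hP : IsStarProjection P) (hX : IsTangentAt P X)
    (h0 : 0 < ‖X‖) {K : Submodule ℂ E}
    (hK : ∀ ξ η, IsPrincipalPair P X ‖X‖ ξ η → ξ ∈ maxSubspace X → η ∈ maxSubspace X →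
      ξ ∈ K ∧ η ∈ K) : maxSubspace X ≤ K := by
  intro v hv
  have hPP : P (P v) = P v := congr($(hP.isIdempotentElem.eq) v)
  have hPv := hX.proj_mem_maxSubspace h0 hv
  rw [← add_sub_cancel (P v) v]
  refine K.add_mem ?_ ?_
  · by_cases h : P v = 0
    · rw [h]; exact K.zero_mem
    · obtain ⟨ξ, η, hp, h1, h2, h3⟩ := (hX.exists_isPrincipalPair hP h0 hPv h).1 hPP
      rw [h3]
      exact K.smul_mem _ (hK ξ η hp h1 h2).1
  · by_cases h : v - P v = 0
    · rw [h]; exact K.zero_mem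
    · obtain ⟨ξ, η, hp, h1, h2, h3⟩ := (hX.exists_isPrincipalPair hP h0
        (Submodule.sub_mem _ hv hPv) h).2 (by rw [map_sub, hPP, sub_self])
      rw [h3]
      exact K.smul_mem _ (hK ξ η hp h1 h2).2

theorem exists_isPrincipalPair [FiniteDimensional ℂ E] (hP : IsStarProjection P)
    (hX : IsTangentAt P X) (h0 : 0 < ‖X‖) :
    ∃ ξ η, IsPrincipalPair P X ‖X‖ ξ η ∧ ξ ∈ maxSubspace X := by
  by_contra! hno
  obtain ⟨v, hv, hv0⟩ := exists_ne_zero_mem_maxSubspace h0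
  refine hv0 ((Submodule.mem_bot ℂ).mp (maxSubspace_le_of_isPrincipalPair hP hX h0 ?_ hv))
  exact fun ξ η hp h1 _ => absurd h1 (hno ξ η hp)

theorem geodesic_mem_maxSubspace (hP : IsStarProjection P) (hX : IsTangentAt P X) (h0 : 0 < ‖X‖)
    (t : ℝ) {v : E} (hv : v ∈ maxSubspace X) : geodesic P X t v ∈ maxSubspace X := by
  have : maxSubspace X ≤ (maxSubspace X).comap (geodesic P X t).toLinearMap := by
    refine maxSubspace_le_of_isPrincipalPair hP hX h0 fun ξ η hp h1 h2 => ?_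
    have hmem : ∀ a b c : ℂ, a • (b • ξ + c • η) ∈ maxSubspace X := fun a b c =>
      Submodule.smul_mem _ _ (Submodule.add_mem _ (Submodule.smul_mem _ _ h1)
        (Submodule.smul_mem _ _ h2))
    constructor
    · change geodesic P X t ξ ∈ maxSubspace X
      rw [hp.geodesic_apply_left]
      exact hmem _ _ _
    · change geodesic P X t η ∈ maxSubspace X
      rw [hp.geodesic_apply_right]
      exact hmem _ _ _
  exact this hv

theorem IsGrassmannCurve.eqOn_maxSubspace (hP : IsStarProjection P) (hX : IsTangentAt P X)
    (h0 : ‖X‖ ∈ Set.Ioo 0 (Real.pi / 2)) {β : ℝ → E →L[ℂ] E}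
    (hβ : IsGrassmannCurve P (geodesic P X 1) β) (hs : HasSpeedLE β ‖X‖) {t : ℝ}
    (ht : t ∈ Set.Icc (0 : ℝ) 1) {v : E} (hv : v ∈ maxSubspace X) :
    β t v = geodesic P X t v := by
  have : maxSubspace X ≤ LinearMap.eqLocus (β t).toLinearMap (geodesic P X t).toLinearMap :=
    maxSubspace_le_of_isPrincipalPair hP hX h0.1 fun ξ η hp _ _ =>
      hp.apply_eq_geodesic_apply h0 hβ hs ht
  exact this hv

theorem norm_le_curveLength [FiniteDimensional ℂ E] (hP : IsStarProjection P)
    (hX : IsTangentAt P X) (h0 : ‖X‖ ∈ Set.Ioo 0 (Real.pi / 2)) {β : ℝ → E →L[ℂ] E}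
    (hβ : IsGrassmannCurve P (geodesic P X 1) β) : ‖X‖ ≤ curveLength β := by
  obtain ⟨ξ, η, hp, _⟩ := exists_isPrincipalPair hP hX h0.1
  exact hp.le_curveLength ⟨h0.1.le, h0.2.le⟩ hP hX.1 hβ

theorem curveLength_geodesic (hP : IsStarProjection P) (hX : IsTangentAt P X) :
    curveLength (geodesic P X) = ‖X‖ := by
  simp [curveLength, norm_deriv_geodesic hP hX]

/-- The derivative at `ξ` is `-d sin(2td) ξ + i d cos(2td) η`. Thus `ξ` alone already detects the
full speed of the geodesic. -/
theorem IsPrincipalPair.norm_deriv_geodesic_apply {d : ℝ} {ξ η : E}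
    (h : IsPrincipalPair P X d ξ η) (t : ℝ) : ‖deriv (geodesic P X) t ξ‖ = |d| := by
  have h1 : HasDerivAt (fun s => geodesic P X s ξ) (deriv (geodesic P X) t ξ) t :=
    (((ContinuousLinearMap.apply ℂ E ξ).restrictScalars ℝ).hasFDerivAt).comp_hasDerivAt t
      ((contDiff_geodesic P X).differentiable (by simp) t).hasDerivAt
  have hc : HasDerivAt (fun s : ℝ => (Real.cos (s * d) : ℂ)) ((-(Real.sin (t * d)) * d : ℝ) : ℂ) t :=
    (((hasDerivAt_id t).mul_const d).cos.congr_deriv (by simp)).ofReal_comp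
  have hs : HasDerivAt (fun s : ℝ => (Real.sin (s * d) : ℂ)) ((Real.cos (t * d) * d : ℝ) : ℂ) t :=
    (((hasDerivAt_id t).mul_const d).sin.congr_deriv (by simp)).ofReal_comp
  have h2 := hc.smul ((hc.smul_const ξ).add ((hs.const_mul Complex.I).smul_const η))
  have h3 := h1.unique (h2.congr_of_eventuallyEq (Filter.Eventually.of_forall
    fun s => h.geodesic_apply_left s))
  have h4 : deriv (geodesic P X) t ξ = ((-(2 * Real.sin (t * d) * Real.cos (t * d)) * d : ℝ) : ℂ) • ξ
      + (Complex.I * (((Real.cos (t * d)) ^ 2 - Real.sin (t * d) ^ 2) * d : ℝ)) • η := by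
    rw [h3]
    simp only [Pi.add_apply]
    push_cast
    module
  refine (pow_left_inj₀ (norm_nonneg _) (abs_nonneg _) two_ne_zero).mp ?_
  rw [h4, h.norm_smul_add_smul_sq, norm_mul, Complex.norm_I, one_mul, Complex.norm_real,
    Complex.norm_real, Real.norm_eq_abs, Real.norm_eq_abs, sq_abs, sq_abs, sq_abs]
  have := Real.cos_sq_add_sin_sq (t * d)
  linear_combination d ^ 2 * (Real.cos (t * d) ^ 2 + Real.sin (t * d) ^ 2 + 1) * this

end MaxSubspace

/-! ### Characterization of minimal curves. -/

section MinimalCurves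

variable {E : Type*} [NormedAddCommGroup E] [InnerProductSpace ℂ E] [CompleteSpace E]
  {P X : E →L[ℂ] E} {δ : ℝ → E →L[ℂ] E}

/-- The constant speed equals the length, which is at most that of the competing geodesic. -/
theorem IsMinimalCurve.hasSpeedLE (hP : IsStarProjection P) (hX : IsTangentAt P X)
    (h : IsMinimalCurve P (geodesic P X 1) δ) : HasSpeedLE δ ‖X‖ := by
  intro t ht hd
  refine (h.constantSpeed.hasSpeedLE_curveLength h.isCurve.piecewiseSmooth t ht hd).trans ?_
  rw [← curveLength_geodesic hP hX]
  exact h.minimal _ (isGrassmannCurve_geodesic hP hX.1)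

variable [FiniteDimensional ℂ E]

/-- Speed at most `‖X‖` already forces constant speed: by rigidity `δ` follows the geodesic on a
principal vector `ξ`, where the derivative has norm `‖X‖`. -/
theorem IsGrassmannCurve.isMinimalCurve (hP : IsStarProjection P) (hX : IsTangentAt P X)
    (h0 : ‖X‖ ∈ Set.Ioo 0 (Real.pi / 2)) (h : IsGrassmannCurve P (geodesic P X 1) δ)
    (hs : HasSpeedLE δ ‖X‖) : IsMinimalCurve P (geodesic P X 1) δ where
  isCurve := h
  constantSpeed := by
    obtain ⟨ξ, η, hp, hξ⟩ := exists_isPrincipalPair hP hX h0.1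
    refine ⟨‖X‖, fun t ht hd => le_antisymm (hs t ht hd) ?_⟩
    let Λ := (ContinuousLinearMap.apply ℂ E ξ).restrictScalars ℝ
    have h1 : HasDerivAt (fun s => δ s ξ) (deriv δ t ξ) t :=
      Λ.hasFDerivAt.comp_hasDerivAt t hd.hasDerivAt
    have h2 : HasDerivAt (fun s => geodesic P X s ξ) (deriv (geodesic P X) t ξ) t :=
      Λ.hasFDerivAt.comp_hasDerivAt t
        ((contDiff_geodesic P X).differentiable (by simp) t).hasDerivAt
    have h3 : deriv δ t ξ = deriv (geodesic P X) t ξ := by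
      refine h1.unique (h2.congr_of_eventuallyEq ?_)
      filter_upwards [Icc_mem_nhds ht.1 ht.2] with s hs'
      exact h.eqOn_maxSubspace hP hX h0 hs hs' hξ
    have h4 := (deriv δ t).le_opNorm ξ
    rwa [h3, hp.norm_deriv_geodesic_apply, hp.norm_left, mul_one, abs_of_pos h0.1] at h4
  minimal β hβ := (hs.curveLength_le h.piecewiseSmooth).trans (norm_le_curveLength hP hX h0 hβ)

theorem contDiff_compressedGeodesic (P X : E →L[ℂ] E) : ContDiff ℝ ∞ (compressedGeodesic P X) :=
  isLinearContraction_compression.contDiff.comp (contDiff_geodesic P X)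

theorem hasSpeedLE_compressedGeodesic (hP : IsStarProjection P) (hX : IsTangentAt P X) :
    HasSpeedLE (compressedGeodesic P X) ‖X‖ :=
  isLinearContraction_compression.hasSpeedLE_comp (contDiff_geodesic P X)
    fun t _ _ => (norm_deriv_geodesic hP hX t).le

theorem isMinimalCurve_iff (hP : IsStarProjection P) (hX : IsTangentAt P X)
    (h0 : ‖X‖ ∈ Set.Ioo 0 (Real.pi / 2)) :
    IsMinimalCurve P (geodesic P X 1) δ ↔
      ∃ α₁ : ℝ → (maxSubspace X)ᗮ →L[ℂ] (maxSubspace X)ᗮ,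
        IsGrassmannCurve (compression (maxSubspace X)ᗮ P)
          (compression (maxSubspace X)ᗮ (geodesic P X 1)) α₁ ∧
        HasSpeedLE α₁ ‖X‖ ∧
        ∀ t ∈ Set.Icc (0 : ℝ) 1,
          δ t = blockDiag (maxSubspace X) (compressedGeodesic P X t) (α₁ t) := by
  have hgeo : ∀ t, ∀ x ∈ maxSubspace X, geodesic P X t x ∈ maxSubspace X := fun t x hx =>
    geodesic_mem_maxSubspace hP hX h0.1 t hx
  have hgeo0 : geodesic P X 0 = P := (isGrassmannCurve_geodesic hP hX.1).source
  constructor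
  · intro h
    have hs := h.hasSpeedLE hP hX
    have hc := h.isCurve
    have heq : ∀ t ∈ Set.Icc (0 : ℝ) 1, ∀ x ∈ maxSubspace X, δ t x = geodesic P X t x :=
      fun t ht x hx => hc.eqOn_maxSubspace hP hX h0 hs ht hx
    have hinv : ∀ t ∈ Set.Icc (0 : ℝ) 1, ∀ x ∈ maxSubspace X, δ t x ∈ maxSubspace X :=
      fun t ht x hx => by rw [heq t ht x hx]; exact hgeo t x hx
    have hblock : ∀ t ∈ Set.Icc (0 : ℝ) 1, δ t = blockDiag (maxSubspace X)
        (compressedGeodesic P X t) (compression (maxSubspace X)ᗮ (δ t)) := fun t ht => by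
      -- A Hermitian operator that leaves `S_X` invariant also leaves its complement invariant, so
      -- `δ t` splits into its two compressions.
      conv_lhs => rw [← blockDiag_compression (hc.mem t ht).isSelfAdjoint (hinv t ht)]
      congr 1
      ext x
      rw [compressedGeodesic, coe_compression_apply, coe_compression_apply, heq t ht x x.2]
    refine ⟨fun t => compression (maxSubspace X)ᗮ (δ t), ⟨?_, ?_, ?_, ?_⟩, ?_, hblock⟩
    · exact isLinearContraction_compression.isPiecewiseSmooth_comp hc.piecewiseSmooth
    · exact fun t ht => isStarProjection_compression (hc.mem t ht)
        (IsSelfAdjoint.map_orthogonal (hc.mem t ht).isSelfAdjoint (hinv t ht))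
    · simp only [hc.source]
    · simp only [hc.target]
    · exact isLinearContraction_blockDiag.hasSpeedLE_of_block isLinearContraction_compression
        (contDiff_compressedGeodesic P X) hs hblock
  · rintro ⟨α₁, hα, hs, hδ⟩
    have hP0 : blockDiag (maxSubspace X) (compressedGeodesic P X 0)
        (compression (maxSubspace X)ᗮ P) = P := by
      rw [compressedGeodesic, hgeo0]
      exact blockDiag_compression hP.isSelfAdjoint fun x hx => hX.proj_mem_maxSubspace h0.1 hx
    refine IsGrassmannCurve.isMinimalCurve hP hX h0 ⟨?_, ?_, ?_, ?_⟩ ?_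
    · exact (hα.piecewiseSmooth.contDiff_comp (contDiff_compressedGeodesic P X)
        isLinearContraction_blockDiag.contDiff).congr hδ
    · intro t ht
      rw [hδ t ht]
      exact isStarProjection_blockDiag
        (isStarProjection_compression (isStarProjection_geodesic hP hX.1 t) (hgeo t)) (hα.mem t ht)
    · rw [hδ 0 (by simp), hα.source, hP0]
    · rw [hδ 1 (by simp), hα.target]
      exact blockDiag_compression (isStarProjection_geodesic hP hX.1 1).isSelfAdjoint (hgeo 1)
    · exact isLinearContraction_blockDiag.hasSpeedLE_block isLinearContraction_compression
        (contDiff_compressedGeodesic P X) (hasSpeedLE_compressedGeodesic hP hX) hs hδ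
        (compression_orthogonal_blockDiag _)

end MinimalCurves

theorem mainTheorem6 (n : ℕ)
    (P Q X : EuclideanSpace ℂ (Fin n) →L[ℂ] EuclideanSpace ℂ (Fin n))
    (hP : P ∈ grassmannian (EuclideanSpace ℂ (Fin n)))
    (hQ : Q ∈ grassmannian (EuclideanSpace ℂ (Fin n)))
    (hPQ : ‖P - Q‖ < 1)
    (hX : IsTangentAt P X) (hXnorm : ‖X‖ < Real.pi / 2) (hXQ : Q = geodesic P X 1) :
    spectrum ℝ (CFC.abs X) ⊆ Set.Ico 0 (Real.pi / 2) ∧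
    ((spectrum ℝ (CFC.abs X)).Nontrivial →
      ∀ δ : ℝ → EuclideanSpace ℂ (Fin n) →L[ℂ] EuclideanSpace ℂ (Fin n),
        IsMinimalCurve P Q δ ↔
          ∃ α₁ : ℝ → (maxSubspace X)ᗮ →L[ℂ] (maxSubspace X)ᗮ,
            IsGrassmannCurve (compression (maxSubspace X)ᗮ P) (compression (maxSubspace X)ᗮ Q) α₁ ∧
            HasSpeedLE α₁ ‖X‖ ∧
            ∀ t ∈ Set.Icc (0 : ℝ) 1,
              δ t = blockDiag (maxSubspace X) (compressedGeodesic P X t) (α₁ t)) := by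
  refine ⟨fun a ha => ?_, fun hnt δ => ?_⟩
  · have := spectrum_abs_subset X ha
    exact ⟨this.1, this.2.trans_lt hXnorm⟩
  · subst hXQ
    -- Two distinct spectral values serve to give `‖X‖ > 0`.
    exact isMinimalCurve_iff hP hX ⟨norm_pos_of_nontrivial_spectrum_abs hnt, hXnorm⟩
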